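/- **Setting.** Let $N\in\mathbb{N}$, $1<p<N$, let $\Omega\subset\mathbb{R}^N$ be an arbitrary (possibly unbounded) open set, and write $|\cdot|_r=|\cdot|_{r,\Omega}$ for the norm of $L^r(\Omega)$. Let $D^{1,p}(\Omega)$ be the completion of $C_c^\infty(\Omega)$ under the norm $\|\varphi\|=\left(\int_\Omega|\nabla\varphi|^p\,dx\right)^{1/p}$, realized through the Sobolev inequality as the space of the functions $u\in L^{p^*}(\Omega)$, $p^*=\frac{Np}{N-p}$, with weak gradient $\nabla u\in L^p(\Omega)^N$, for which there are $\varphi_n\in C_c^\infty(\Omega)$ with $\varphi_n\to u$ in $L^{p^*}(\Omega)$ and $\nabla\varphi_n\to\nabla u$ in $L^p(\Omega)$. Let $\mathcal A:\Omega\times\mathbb{R}\times\mathbb{R}^N\to\mathbb{R}^N$ and $\mathcal B:\Omega\times\mathbb{R}\times\mathbb{R}^N\to\mathbb{R}$ be Carathéodory functions such that, for almost every $x\in\Omega$ and all $\zeta\in\mathbb{R}$, $\xi\in\mathbb{R}^N$, $$\mathcal A(x,\zeta,\xi)\cdot\xi\ \ge\ \lambda|\xi|^p-a_1(x)|\zeta|^p-a_2(x),\qquad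 |\mathcal B(x,\zeta,\xi)|\ \le\ b_1(x)|\xi|^{p-1}+b_2(x)|\zeta|^{p-1}+b_3(x),$$ where $\lambda>0$ is a constant and $a_1,a_2,b_1,b_2,b_3\ge 0$ satisfy, for some $q>N$ and some $\beta>p$, $$b_1\in L^\infty(\Omega),\quad a_1,b_2\in L^{q/p}(\Omega),\quad a_2\in L^{\beta/p}(\Omega)\cap L^\infty(\Omega),\quad b_3\in L^{\beta/(p-1)}(\Omega)\cap L^\infty(\Omega).$$ Put $\|a_2\|=|a_2|_{\beta/p}+|a_2|_\infty$ and $\|b_3\|=|b_3|_{\beta/(p-1)}+|b_3|_\infty$. Let $u\in D^{1,p}(\Omega)\cap L^\beta(\Omega)$ be a weak subsolution of $-\operatorname{div}\mathcal A(x,u,\nabla u)=\mathcal B(x,u,\nabla u)$, that is, $$\int_\Omega\mathcal A(x,u,\nabla u)\cdot\nabla\phi\,dx\ \le\ \int_\Omega\mathcal B(x,u,\nabla u)\,\phi\,dx\qquad\text{for all }\phi\in D^{1,p}(\Omega),\ \phi\ge 0,$$ where the existence of the left-hand integral and the inequality are required for those $\phi$ for which $\mathcal B(x,u,\nabla u)\phi$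 is integrable. **Corollary 2.2.** There is $\theta_0=\theta_0(p,\beta,N)$ with $0<\theta_0\le 1$, depending only on $p,\beta,N$, such that $u^+=\max\{u,0\}$ satisfies $$\operatorname*{ess\,sup}_{\Omega}u^+\ \le\ C\max\{|u^+|_\beta^{\theta_0},\,|u^+|_\beta\},$$ where $C=C\big(|b_1|_\infty,|a_1|_{q/p},|b_2|_{q/p},\|a_2\|,\|b_3\|\big)$ is a nondecreasing function of these five norms that is determined by $p,q,\beta,N,\lambda$ alone (and not by $\Omega$, $\mathcal A$, $\mathcal B$ or $u$ otherwise). -/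

import Mathlib

open MeasureTheory Filter Topology
open scoped NNReal ENNReal ContDiff

/-- The critical Sobolev exponent `p* = N p / (N - p)`, for `1 < p < N`. -/
noncomputable def sobolevExponent (N : ℕ) (p : ℝ) : ℝ := N * p / (N - p)

/-- `IsBeppoLevi Ω p u Du`: the function `u` belongs to the Beppo-Levi space `D^{1,p}(Ω)`,
`1 < p < N`, and `Du` is its gradient.

The space is the completion of `C_c^∞(Ω)` in the norm `φ ↦ |∇φ|_p`. By the Sobolev inequality
a sequence in `C_c^∞(Ω)` that is Cauchy in this norm converges in `L^{p*}(Ω)`, and the completion is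
the space of the limit functions `u`; the `L^p`-limit `Du` of the gradients is the
weak gradient of `u`, so it is determined by `u` almost everywhere in `Ω`. -/
def IsBeppoLevi {N : ℕ} (Ω : Set (EuclideanSpace ℝ (Fin N))) (p : ℝ)
    (u : EuclideanSpace ℝ (Fin N) → ℝ)
    (Du : EuclideanSpace ℝ (Fin N) → EuclideanSpace ℝ (Fin N)) : Prop :=
  MemLp u (ENNReal.ofReal (sobolevExponent N p)) (volume.restrict Ω) ∧
  MemLp Du (ENNReal.ofReal p) (volume.restrict Ω) ∧
  ∃ φ : ℕ → EuclideanSpace ℝ (Fin N) → ℝ,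
    (∀ n, ContDiff ℝ ∞ (φ n) ∧ HasCompactSupport (φ n) ∧ tsupport (φ n) ⊆ Ω) ∧
    Tendsto (fun n => eLpNorm (fun x => φ n x - u x)
      (ENNReal.ofReal (sobolevExponent N p)) (volume.restrict Ω)) atTop (𝓝 0) ∧
    Tendsto (fun n => eLpNorm (fun x => gradient (φ n) x - Du x)
      (ENNReal.ofReal p) (volume.restrict Ω)) atTop (𝓝 0)

/-- Carathéodory functions of `(x, ζ, ξ) ∈ Ω × ℝ × ℝ^N`: Lebesgue measurable in `x ∈ Ω` for all
`(ζ, ξ)`, and continuous in `(ζ, ξ)` for almost every `x ∈ Ω`. -/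
structure IsCaratheodory {N : ℕ} {F : Type*} [TopologicalSpace F]
    (Ω : Set (EuclideanSpace ℝ (Fin N)))
    (f : EuclideanSpace ℝ (Fin N) → ℝ → EuclideanSpace ℝ (Fin N) → F) : Prop where
  measurable : ∀ (ζ : ℝ) (ξ : EuclideanSpace ℝ (Fin N)),
    AEStronglyMeasurable (fun x => f x ζ ξ) (volume.restrict Ω)
  continuous : ∀ᵐ x ∂(volume.restrict Ω),
    Continuous (fun z : ℝ × EuclideanSpace ℝ (Fin N) => f x z.1 z.2)

/-- `A(x, ζ, ξ) · ξ ≥ lam |ξ|^p - a₁(x) |ζ|^p - a₂(x)`, for almost every `x ∈ Ω`. -/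
def StructureA {N : ℕ} (Ω : Set (EuclideanSpace ℝ (Fin N))) (p lam : ℝ)
    (a₁ a₂ : EuclideanSpace ℝ (Fin N) → ℝ)
    (A : EuclideanSpace ℝ (Fin N) → ℝ → EuclideanSpace ℝ (Fin N) → EuclideanSpace ℝ (Fin N)) :
    Prop :=
  ∀ᵐ x ∂(volume.restrict Ω), ∀ (ζ : ℝ) (ξ : EuclideanSpace ℝ (Fin N)),
    lam * ‖ξ‖ ^ p - a₁ x * |ζ| ^ p - a₂ x ≤ inner ℝ (A x ζ ξ) ξ

/-- `|B(x, ζ, ξ)| ≤ b₁(x) |ξ|^(p-1) + b₂(x) |ζ|^(p-1) + b₃(x)`, for almost every `x ∈ Ω`. -/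
def StructureB {N : ℕ} (Ω : Set (EuclideanSpace ℝ (Fin N))) (p : ℝ)
    (b₁ b₂ b₃ : EuclideanSpace ℝ (Fin N) → ℝ)
    (B : EuclideanSpace ℝ (Fin N) → ℝ → EuclideanSpace ℝ (Fin N) → ℝ) : Prop :=
  ∀ᵐ x ∂(volume.restrict Ω), ∀ (ζ : ℝ) (ξ : EuclideanSpace ℝ (Fin N)),
    |B x ζ ξ| ≤ b₁ x * ‖ξ‖ ^ (p - 1) + b₂ x * |ζ| ^ (p - 1) + b₃ x

/-- `u ∈ D^{1,p}(Ω)`, with gradient `Du`, is a weak subsolution of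
`- div A(x, u, ∇u) = B(x, u, ∇u)` in `Ω`: one has `∫ A(x, u, ∇u) · ∇φ ≤ ∫ B(x, u, ∇u) φ` for all
nonnegative `φ ∈ D^{1,p}(Ω)`. As `A` has no upper growth bound and `B(x, u, ∇u) φ` need not be
integrable in a domain of infinite measure, the requirement (existence of the left-hand integral
included) is made for those `φ` for which the right-hand integral exists. -/
structure IsWeakSubsolution {N : ℕ} (Ω : Set (EuclideanSpace ℝ (Fin N))) (p : ℝ)
    (A : EuclideanSpace ℝ (Fin N) → ℝ → EuclideanSpace ℝ (Fin N) → EuclideanSpace ℝ (Fin N))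
    (B : EuclideanSpace ℝ (Fin N) → ℝ → EuclideanSpace ℝ (Fin N) → ℝ)
    (u : EuclideanSpace ℝ (Fin N) → ℝ)
    (Du : EuclideanSpace ℝ (Fin N) → EuclideanSpace ℝ (Fin N)) : Prop where
  mem : IsBeppoLevi Ω p u Du
  le : ∀ (φ : EuclideanSpace ℝ (Fin N) → ℝ)
    (Dφ : EuclideanSpace ℝ (Fin N) → EuclideanSpace ℝ (Fin N)),
    IsBeppoLevi Ω p φ Dφ → (∀ᵐ x ∂(volume.restrict Ω), 0 ≤ φ x) →
    IntegrableOn (fun x => B x (u x) (Du x) * φ x) Ω →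
      IntegrableOn (fun x => inner ℝ (A x (u x) (Du x)) (Dφ x)) Ω ∧
      ∫ x in Ω, inner ℝ (A x (u x) (Du x)) (Dφ x) ≤ ∫ x in Ω, B x (u x) (Du x) * φ x

/-- The norm `|f|_{r,Ω}` of `L^r(Ω)`, `0 < r ≤ ∞`, as a finite number (for `f ∈ L^r(Ω)`). -/
noncomputable def normOn {N : ℕ} {F : Type*} [NormedAddCommGroup F]
    (Ω : Set (EuclideanSpace ℝ (Fin N))) (r : ℝ≥0∞) (f : EuclideanSpace ℝ (Fin N) → F) : ℝ≥0 :=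
  (eLpNorm f r (volume.restrict Ω)).toNNReal

/-! The proof is De Giorgi's level-set method, applied to `m k`, the measure of `{u > k}` for `k >
0`. Testing with a smooth substitute for `(u - k)^+` and absorbing half of the gradient term bounds
the energy above level `k` by lower order terms supported in `{u > k}`
(`IsWeakSubsolution.lintegral_gradient_le`). Only the coercivity of `A` is needed, and `a₂`, `b₃`
enter through their sup norms.

The Sobolev inequality turns the energy into `X = |(u - k)^+|_{p*}^p`, and Hölder's inequality
bounds the lower order terms by `X m^δ₁ + m^b (k^p m^δ₁ + m^δ₂)` up to a constant, with `b = p /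
p*`, `δ₁ = p / N - p / q`, `δ₂ = p / N`. Since `q > N`, `δ₁` is positive: where `m` is small the `X`
term is absorbed, and Chebyshev's inequality gives `level_decay`, in which the power of `m k` on the
right exceeds the power `b` of `m l` on the left. Such a recursion forces `m (2 * K) = 0` once `m K`
is small (`deGiorgi_iteration`).

The smallness comes from `m K ≤ (|u^+|_β / K)^β`, which also makes the level sets of finite measure
in an unbounded `Ω`. The inhomogeneous term `m^δ₂` does not scale with `k^p`; balancing it against
`K^p` gives `θ₀ = β / (β + N)`. Keeping `δ₂` there instead of `δ₁` makes `θ₀` independent of `q`. -/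

/-! ### Smooth substitutes for the truncation `(t - k)^+`. -/

/-- The smooth convex ramp vanishing for `t ≤ k` whose slope increases from `0` at `k`
to `1` at `h`. -/
noncomputable def smoothRamp (k h t : ℝ) : ℝ :=
  ∫ s in k..t, Real.smoothTransition ((s - k) / (h - k))

/-- The derivative of `smoothRamp k h`. -/
noncomputable def smoothRampSlope (k h t : ℝ) : ℝ := Real.smoothTransition ((t - k) / (h - k))

namespace smoothRamp

variable {k h : ℝ}

lemma slope_contDiff : ContDiff ℝ ∞ (smoothRampSlope k h) := by
  unfold smoothRampSlope
  exact Real.smoothTransition.contDiff.comp ((contDiff_id.sub contDiff_const).div_const _)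

lemma slope_continuous : Continuous (smoothRampSlope k h) := slope_contDiff.continuous

lemma slope_nonneg (t : ℝ) : 0 ≤ smoothRampSlope k h t := Real.smoothTransition.nonneg _

lemma slope_le_one (t : ℝ) : smoothRampSlope k h t ≤ 1 := Real.smoothTransition.le_one _

lemma slope_mono (hkh : k < h) : Monotone (smoothRampSlope k h) := fun a b hab =>
  Real.smoothTransition.monotone (by
    have : 0 < h - k := sub_pos.2 hkh
    gcongr)

lemma slope_eq_zero (hkh : k < h) {t : ℝ} (ht : t ≤ k) : smoothRampSlope k h t = 0 :=
  Real.smoothTransition.zero_of_nonpos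
    (div_nonpos_of_nonpos_of_nonneg (by linarith) (by linarith))

lemma slope_eq_one (hkh : k < h) {t : ℝ} (ht : h ≤ t) : smoothRampSlope k h t = 1 :=
  Real.smoothTransition.one_of_one_le ((one_le_div (by linarith)).2 (by linarith))

lemma hasDerivAt (t : ℝ) : HasDerivAt (smoothRamp k h) (smoothRampSlope k h t) t :=
  intervalIntegral.integral_hasDerivAt_right (slope_continuous.intervalIntegrable _ _)
    (slope_continuous.stronglyMeasurableAtFilter _ _) slope_continuous.continuousAt

lemma deriv_eq : deriv (smoothRamp k h) = smoothRampSlope k h :=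
  funext fun t => (hasDerivAt t).deriv

lemma contDiff : ContDiff ℝ ∞ (smoothRamp k h) :=
  contDiff_infty_iff_deriv.2
    ⟨fun t => (hasDerivAt t).differentiableAt, by rw [deriv_eq]; exact slope_contDiff⟩

lemma eq_zero (hkh : k < h) {t : ℝ} (ht : t ≤ k) : smoothRamp k h t = 0 := by
  unfold smoothRamp
  rw [intervalIntegral.integral_congr (g := fun _ => (0 : ℝ)), intervalIntegral.integral_zero]
  intro s hs
  rw [Set.uIcc_of_ge ht] at hs
  exact slope_eq_zero hkh hs.2

lemma nonneg (hkh : k < h) (t : ℝ) : 0 ≤ smoothRamp k h t := by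
  rcases le_total t k with ht | ht
  · exact (eq_zero hkh ht).ge
  · exact intervalIntegral.integral_nonneg ht fun s _ => slope_nonneg s

/-- Convexity of the ramp. -/
lemma le_slope_mul (hkh : k < h) {t : ℝ} (ht : k ≤ t) :
    smoothRamp k h t ≤ smoothRampSlope k h t * (t - k) := by
  calc smoothRamp k h t ≤ ∫ _ in k..t, smoothRampSlope k h t :=
        intervalIntegral.integral_mono_on ht (slope_continuous.intervalIntegrable _ _)
          intervalIntegrable_const fun s hs => slope_mono hkh hs.2
    _ = smoothRampSlope k h t * (t - k) := by simp [mul_comm]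

/-- Beyond `h` the slope is one and the value at `h` is nonnegative. This lower bound recovers `(u -
h)^+` from the ramp after the Sobolev inequality. -/
lemma sub_le (hkh : k < h) (t : ℝ) : t - h ≤ smoothRamp k h t := by
  rcases le_total t h with ht | ht
  · linarith [nonneg hkh t]
  · have h1 : smoothRamp k h t = smoothRamp k h h + ∫ s in h..t, smoothRampSlope k h s :=
      (intervalIntegral.integral_add_adjacent_intervals
        (slope_continuous.intervalIntegrable _ _) (slope_continuous.intervalIntegrable _ _)).symm
    have h2 : ∫ s in h..t, smoothRampSlope k h s = t - h := by
      rw [intervalIntegral.integral_congr (g := fun _ => (1 : ℝ))]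
      · simp
      · intro s hs
        rw [Set.uIcc_of_le ht] at hs
        exact slope_eq_one hkh hs.1
    linarith [nonneg hkh h]

end smoothRamp

/-! ### Sobolev inequality and chain rule in the Beppo-Levi space. -/

lemma norm_gradient {N : ℕ} (f : EuclideanSpace ℝ (Fin N) → ℝ) (x : EuclideanSpace ℝ (Fin N)) :
    ‖gradient f x‖ = ‖fderiv ℝ f x‖ := by
  simp [gradient]

lemma continuous_gradient {N : ℕ} {f : EuclideanSpace ℝ (Fin N) → ℝ} (hf : ContDiff ℝ ∞ f) :
    Continuous (gradient f) :=
  (LinearIsometryEquiv.continuous _).comp (hf.continuous_fderiv (by simp))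

lemma sobolevExponent_pos {N : ℕ} {p : ℝ} (hp : 1 < p) (hpN : p < N) :
    0 < sobolevExponent N p := div_pos (by nlinarith) (by linarith)

lemma inv_sobolevExponent {N : ℕ} {p : ℝ} (hp : 1 < p) (hpN : p < N) :
    (sobolevExponent N p)⁻¹ = p⁻¹ - (N : ℝ)⁻¹ := by
  have h1 : (N : ℝ) ≠ 0 := by linarith
  have h2 : p ≠ 0 := by linarith
  unfold sobolevExponent
  field_simp

lemma tendsto_eLpNorm_of_tendsto_sub {α E : Type*} [MeasurableSpace α] {μ : Measure α}
    [NormedAddCommGroup E] {r : ℝ≥0∞} (hr : 1 ≤ r) {f : ℕ → α → E} {g : α → E}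
    (hf : ∀ n, AEStronglyMeasurable (f n) μ) (hg : MemLp g r μ)
    (h : Tendsto (fun n => eLpNorm (fun x => f n x - g x) r μ) atTop (𝓝 0)) :
    Tendsto (fun n => eLpNorm (f n) r μ) atTop (𝓝 (eLpNorm g r μ)) := by
  have hub : ∀ n, eLpNorm (f n) r μ ≤ eLpNorm g r μ + eLpNorm (fun x => f n x - g x) r μ :=
    fun n => by
      have := eLpNorm_add_le hg.1 ((hf n).sub hg.1) hr
      rwa [add_sub_cancel] at this
  have hlb : ∀ n, eLpNorm g r μ - eLpNorm (fun x => f n x - g x) r μ ≤ eLpNorm (f n) r μ :=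
    fun n => by
      rw [tsub_le_iff_right]
      have := eLpNorm_sub_le (hf n) ((hf n).sub hg.1) hr
      rwa [sub_sub_cancel] at this
  refine tendsto_of_tendsto_of_tendsto_of_le_of_le ?_ ?_ hlb hub
  · simpa using ENNReal.Tendsto.sub tendsto_const_nhds h (Or.inl hg.eLpNorm_ne_top)
  · simpa using tendsto_const_nhds.add h

/-- The Sobolev inequality in `D^{1,p}(Ω)`. -/
theorem exists_sobolev_const {N : ℕ} {p : ℝ} (hp : 1 < p) (hpN : p < N) :
    ∃ S : ℝ≥0, ∀ (Ω : Set (EuclideanSpace ℝ (Fin N))) (u : EuclideanSpace ℝ (Fin N) → ℝ)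
      (Du : EuclideanSpace ℝ (Fin N) → EuclideanSpace ℝ (Fin N)), IsBeppoLevi Ω p u Du →
      eLpNorm u (ENNReal.ofReal (sobolevExponent N p)) (volume.restrict Ω) ≤
        S * eLpNorm Du (ENNReal.ofReal p) (volume.restrict Ω) := by
  refine ⟨SNormLESNormFDerivOfEqConst ℝ (volume : Measure (EuclideanSpace ℝ (Fin N)))
    (p.toNNReal : ℝ), fun Ω u Du ⟨hu, hDu, φ, hφ, hφu, hφD⟩ => ?_⟩
  have hN : (0 : ℝ) < N := by linarith
  have hs1 : 1 ≤ sobolevExponent N p := by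
    unfold sobolevExponent
    rw [le_div_iff₀ (by linarith)]
    nlinarith
  -- Both norms are continuous along the approximating sequence, so test functions suffice. Their
  -- supports lie in `Ω`, so the norms over `Ω` are those over the whole space.
  refine le_of_tendsto_of_tendsto
    (tendsto_eLpNorm_of_tendsto_sub (by simpa using ENNReal.ofReal_le_ofReal hs1)
      (fun n => (hφ n).1.continuous.aestronglyMeasurable) hu hφu)
    (ENNReal.Tendsto.const_mul (tendsto_eLpNorm_of_tendsto_sub
      (by simpa using ENNReal.ofReal_le_ofReal hp.le)
      (fun n => (continuous_gradient (hφ n).1).aestronglyMeasurable) hDu hφD)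
      (Or.inr ENNReal.coe_ne_top)) (Eventually.of_forall fun n => ?_)
  obtain ⟨h1, h2, h3⟩ := hφ n
  have hg : Function.support (gradient (φ n)) ⊆ Ω := by
    intro x hx
    refine h3 (support_fderiv_subset ℝ ?_)
    rw [Function.mem_support, ← norm_ne_zero_iff] at hx ⊢
    rwa [← norm_gradient]
  simp only
  rw [eLpNorm_restrict_eq_of_support_subset ((subset_tsupport _).trans h3),
    eLpNorm_restrict_eq_of_support_subset hg,
    eLpNorm_congr_norm_ae (Eventually.of_forall (norm_gradient (φ n)))]
  refine eLpNorm_le_eLpNorm_fderiv_of_eq volume (h1.of_le (by simp)) h2 ?_ ?_ ?_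
  · exact Real.one_le_toNNReal.2 hp.le
  · simpa using hN
  · rw [Real.coe_toNNReal _ (sobolevExponent_pos hp hpN).le, NNReal.coe_inv,
      Real.coe_toNNReal p (by linarith)]
    simp [inv_sobolevExponent hp hpN]

lemma gradient_comp {N : ℕ} {G : ℝ → ℝ} {G' : ℝ} {f : EuclideanSpace ℝ (Fin N) → ℝ}
    {x : EuclideanSpace ℝ (Fin N)} (hG : HasDerivAt G G' (f x)) (hf : DifferentiableAt ℝ f x) :
    gradient (fun y => G (f y)) x = G' • gradient f x := by
  have := hG.comp_hasFDerivAt x hf.hasFDerivAt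
  simp only [gradient]
  rw [show (fun y => G (f y)) = G ∘ f from rfl, this.fderiv]
  simp

/-- Chain rule in `D^{1,p}(Ω)` for smooth contractions vanishing at the origin. -/
theorem IsBeppoLevi.comp {N : ℕ} {p : ℝ} (hp : 1 < p) (hpN : p < N)
    {Ω : Set (EuclideanSpace ℝ (Fin N))} {u : EuclideanSpace ℝ (Fin N) → ℝ}
    {Du : EuclideanSpace ℝ (Fin N) → EuclideanSpace ℝ (Fin N)} (hu : IsBeppoLevi Ω p u Du)
    {G G' : ℝ → ℝ} (hG : ContDiff ℝ ∞ G) (hG' : ∀ t, HasDerivAt G (G' t) t)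
    (hG'c : Continuous G') (hG'b : ∀ t, |G' t| ≤ 1) (hG0 : G 0 = 0) :
    IsBeppoLevi Ω p (fun x => G (u x)) (fun x => G' (u x) • Du x) := by
  obtain ⟨hu1, hDu, φ, hφ, hφu, hφD⟩ := hu
  have hlip : ∀ a b, |G a - G b| ≤ |a - b| := fun a b => by
    have : LipschitzWith 1 G :=
      lipschitzWith_of_nnnorm_deriv_le (fun t => (hG' t).differentiableAt) fun t => by
        rw [(hG' t).deriv, ← NNReal.coe_le_coe, coe_nnnorm]
        exact hG'b t
    simpa [Real.dist_eq] using this.dist_le_mul a b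
  have hp0 : ENNReal.ofReal p ≠ 0 := by simp; linarith
  have hp1 : 1 ≤ ENNReal.ofReal p := by simpa using ENNReal.ofReal_le_ofReal hp.le
  have hs0 : ENNReal.ofReal (sobolevExponent N p) ≠ 0 := by
    simpa using sobolevExponent_pos hp hpN
  -- The gradient limit needs `G' (φ n) → G' u` almost everywhere, hence a subsequence. The
  -- compositions remain test functions because `G` is smooth and `G 0 = 0`.
  obtain ⟨ns, hns, hae⟩ := (tendstoInMeasure_of_tendsto_eLpNorm hs0
    (fun n => (hφ n).1.continuous.aestronglyMeasurable) hu1.1 hφu).exists_seq_tendsto_ae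
  have hG'm : AEStronglyMeasurable (fun x => G' (u x)) (volume.restrict Ω) :=
    hG'c.comp_aestronglyMeasurable hu1.1
  refine ⟨?_, ?_, fun n x => G (φ (ns n) x), fun n => ⟨hG.comp (hφ _).1, ?_, ?_⟩, ?_, ?_⟩
  · refine hu1.mono (hG.continuous.comp_aestronglyMeasurable hu1.1)
      (Eventually.of_forall fun x => ?_)
    simpa [hG0] using hlip (u x) 0
  · refine hDu.mono (hG'm.smul hDu.1) (Eventually.of_forall fun x => ?_)
    rw [norm_smul]
    exact mul_le_of_le_one_left (norm_nonneg _) (hG'b _)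
  · exact (hφ _).2.1.comp_left hG0
  · refine (closure_mono fun x hx => ?_).trans (hφ (ns n)).2.2
    rw [Function.mem_support] at hx ⊢
    intro h
    exact hx (by simp only [h, hG0])
  · refine tendsto_of_tendsto_of_tendsto_of_le_of_le tendsto_const_nhds
      (hφu.comp hns.tendsto_atTop) (fun _ => zero_le) fun n => ?_
    exact eLpNorm_mono fun x => hlip _ _
  -- The gradient error splits into `G' (φ) • (∇φ - Du)`, small because `|G'| ≤ 1`, and `(G' (φ) -
  -- G' (u)) • Du`, which tends to zero by dominated convergence with majorant `(2 |Du|)^p`.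
  · have hdom : Tendsto (fun n => eLpNorm (fun x => (G' (φ (ns n) x) - G' (u x)) • Du x)
        (ENNReal.ofReal p) (volume.restrict Ω)) atTop (𝓝 0) := by
      have hpt : ENNReal.ofReal p ≠ ⊤ := ENNReal.ofReal_ne_top
      have hpr : (ENNReal.ofReal p).toReal = p := ENNReal.toReal_ofReal (by linarith)
      have key : Tendsto (fun n => ∫⁻ x, ‖(G' (φ (ns n) x) - G' (u x)) • Du x‖ₑ ^ p
          ∂(volume.restrict Ω)) atTop (𝓝 (∫⁻ _, 0 ∂(volume.restrict Ω))) := by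
        refine tendsto_lintegral_of_dominated_convergence' (fun x => (2 * ‖Du x‖ₑ) ^ p)
          (fun n => ?_) (fun n => Eventually.of_forall fun x => ?_) ?_ ?_
        · exact (((hG'c.comp (hφ _).1.continuous).aestronglyMeasurable.sub
            hG'm).smul hDu.1).enorm.pow_const _
        · simp only
          rw [enorm_smul]
          gcongr
          have : ‖G' (φ (ns n) x) - G' (u x)‖ ≤ 2 := by
            have h1 := hG'b (φ (ns n) x)
            have h2 := hG'b (u x)
            rw [Real.norm_eq_abs]
            linarith [abs_sub (G' (φ (ns n) x)) (G' (u x))]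
          rw [← ofReal_norm]
          simpa using ENNReal.ofReal_le_ofReal this
        · have : ∀ x, (2 * ‖Du x‖ₑ) ^ p = 2 ^ p * ‖Du x‖ₑ ^ p := fun x =>
            ENNReal.mul_rpow_of_nonneg _ _ (by linarith)
          simp only [this]
          rw [lintegral_const_mul' _ _ (by simp)]
          refine ENNReal.mul_ne_top (by simp) ?_
          have := lintegral_rpow_enorm_lt_top_of_eLpNorm_lt_top hp0 hpt hDu.2
          rw [hpr] at this
          exact this.ne
        · filter_upwards [hae] with x hx
          have h1 : Tendsto (fun n => (G' (φ (ns n) x) - G' (u x)) • Du x) atTop (𝓝 0) := by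
            simpa using ((((hG'c.tendsto _).comp hx).sub_const (G' (u x))).smul_const (Du x))
          have h2 := (ENNReal.continuous_rpow_const (y := p)).tendsto _ |>.comp h1.enorm
          simpa [Function.comp_def, ENNReal.zero_rpow_of_pos (show 0 < p by linarith)] using h2
      simp only [lintegral_zero] at key
      have h3 := ((ENNReal.continuous_rpow_const (y := 1 / p)).tendsto _).comp key
      rw [ENNReal.zero_rpow_of_pos (by positivity)] at h3
      refine h3.congr fun n => ?_
      rw [eLpNorm_eq_lintegral_rpow_enorm_toReal hp0 hpt, hpr]
      rfl
    have hsum := (hφD.comp hns.tendsto_atTop).add hdom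
    rw [add_zero] at hsum
    refine tendsto_of_tendsto_of_tendsto_of_le_of_le tendsto_const_nhds hsum
      (fun _ => zero_le) fun n => ?_
    have hgm : AEStronglyMeasurable (gradient (φ (ns n))) (volume.restrict Ω) :=
      (continuous_gradient (hφ _).1).aestronglyMeasurable
    have hcm : AEStronglyMeasurable (fun x => G' (φ (ns n) x)) (volume.restrict Ω) :=
      (hG'c.comp (hφ _).1.continuous).aestronglyMeasurable
    have heq : (fun x => gradient (fun y => G (φ (ns n) y)) x - G' (u x) • Du x) =
        (fun x => G' (φ (ns n) x) • (gradient (φ (ns n)) x - Du x)) +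
          fun x => (G' (φ (ns n) x) - G' (u x)) • Du x := by
      funext x
      rw [gradient_comp (hG' _) ((hφ _).1.differentiable (by simp) x)]
      simp only [Pi.add_apply]
      module
    simp only [heq]
    refine (eLpNorm_add_le (hcm.smul (hgm.sub hDu.1)) ((hcm.sub hG'm).smul hDu.1) hp1).trans ?_
    gcongr
    · refine eLpNorm_mono fun x =>
        (norm_smul (G' (φ (ns n) x)) (gradient (φ (ns n)) x - Du x)).trans_le ?_
      exact mul_le_of_le_one_left (norm_nonneg _) (hG'b _)
    · rfl

/-! ### Energy inequality on superlevel sets. -/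

/-- The superposition of a Carathéodory function with measurable functions is measurable. -/
theorem IsCaratheodory.aestronglyMeasurable_comp {N : ℕ} {Ω : Set (EuclideanSpace ℝ (Fin N))}
    {f : EuclideanSpace ℝ (Fin N) → ℝ → EuclideanSpace ℝ (Fin N) → ℝ} (hf : IsCaratheodory Ω f)
    {u : EuclideanSpace ℝ (Fin N) → ℝ} {Du : EuclideanSpace ℝ (Fin N) → EuclideanSpace ℝ (Fin N)}
    (hu : AEStronglyMeasurable u (volume.restrict Ω))
    (hDu : AEStronglyMeasurable Du (volume.restrict Ω)) :
    AEStronglyMeasurable (fun x => f x (u x) (Du x)) (volume.restrict Ω) := by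
  have hz : AEStronglyMeasurable (fun x => (u x, Du x)) (volume.restrict Ω) := hu.prodMk hDu
  obtain ⟨z, hzm, hze⟩ := hz
  refine aestronglyMeasurable_of_tendsto_ae atTop
    (f := fun n x => f x (hzm.approx n x).1 (hzm.approx n x).2) (fun n => ?_) ?_
  -- Along a simple function the superposition is a finite sum of sections `f · ζ ξ` cut off to the
  -- fibers.
  · have : (fun x => f x (hzm.approx n x).1 (hzm.approx n x).2) = fun x =>
        ∑ c ∈ (hzm.approx n).range, (hzm.approx n ⁻¹' {c}).indicator (fun x => f x c.1 c.2) x := by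
      funext x
      rw [Finset.sum_eq_single (hzm.approx n x)]
      · simp
      · intro c _ hc
        rw [Set.indicator_of_notMem]
        simpa using fun h => hc h.symm
      · intro h
        exact absurd (SimpleFunc.mem_range_self _ _) h
    rw [this]
    exact Finset.aestronglyMeasurable_fun_sum _ fun c _ =>
      (hf.measurable c.1 c.2).indicator (SimpleFunc.measurableSet_fiber _ _)
  · filter_upwards [hf.continuous, hze] with x hx hzx
    have h1 := (hx.tendsto (z x)).comp (hzm.tendsto_approx x)
    simp only [← hzx] at h1
    exact h1

/-- The source term in the energy inequality on the superlevel set `{t > k}`. -/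
noncomputable def levelSource (p P k d t : ℝ) : ℝ :=
  if k < t then 2 ^ p * d * ((t - k) ^ p + k ^ p) + P * ((t - k) ^ p + k ^ p + 1) else 0

lemma levelSource_nonneg {p P k d t : ℝ} (hP : 0 ≤ P) (hk : 0 < k) (hd : 0 ≤ d) :
    0 ≤ levelSource p P k d t := by
  unfold levelSource
  split_ifs with h
  · have : 0 < t - k := sub_pos.2 h
    positivity
  · rfl

lemma measurable_levelSource (p P k : ℝ) :
    Measurable fun z : ℝ × ℝ => levelSource p P k z.1 z.2 := by
  unfold levelSource
  exact Measurable.ite (measurableSet_lt measurable_const measurable_snd) (by fun_prop)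
    measurable_const

lemma add_rpow_le_two_rpow_mul {a b p : ℝ} (ha : 0 ≤ a) (hb : 0 ≤ b) (hp : 0 < p) :
    (a + b) ^ p ≤ 2 ^ p * (a ^ p + b ^ p) := by
  wlog hab : a ≤ b generalizing a b
  · rw [add_comm a b, add_comm (a ^ p)]
    exact this hb ha (le_of_not_ge hab)
  calc (a + b) ^ p ≤ (2 * b) ^ p := by gcongr; linarith
    _ = 2 ^ p * b ^ p := Real.mul_rpow (by norm_num) hb
    _ ≤ 2 ^ p * (a ^ p + b ^ p) := by
      gcongr
      exact le_add_of_nonneg_left (Real.rpow_nonneg ha p)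

/-- Young's inequality with the weight `lam / 2` that can be absorbed; comparing `y` with `lam / 2 *
X` gives an explicit constant. -/
lemma rpow_sub_one_mul_le {X y p lam : ℝ} (hX : 0 ≤ X) (hy : 0 ≤ y) (hp : 1 < p)
    (hlam : 0 < lam) :
    y * X ^ (p - 1) ≤ lam / 2 * X ^ p + (2 / lam) ^ (p - 1) * y ^ p := by
  have hsplit : ∀ {z : ℝ}, 0 ≤ z → z * z ^ (p - 1) = z ^ p := fun {z} hz => by
    rw [← Real.rpow_one_add' hz (by linarith)]
    ring_nf
  rcases le_total y (lam / 2 * X) with h | h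
  · calc y * X ^ (p - 1) ≤ lam / 2 * X * X ^ (p - 1) := by gcongr
      _ = lam / 2 * X ^ p := by rw [mul_assoc, hsplit hX]
      _ ≤ _ := le_add_of_nonneg_right (by positivity)
  · have hXy : X ≤ 2 / lam * y := by
      rw [div_mul_eq_mul_div, le_div_iff₀ hlam]
      linarith
    calc y * X ^ (p - 1) ≤ y * (2 / lam * y) ^ (p - 1) := by gcongr
      _ = (2 / lam) ^ (p - 1) * y ^ p := by
        rw [Real.mul_rpow (by positivity) hy, ← hsplit hy]
        ring
      _ ≤ _ := le_add_of_nonneg_left (by positivity)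

/-- Convexity of the ramp enters as `w ≤ g * (t - k)`: every term then carries the factor `g`, so
the gradient part has the same weight as the coercive term `lam * g * X ^ p` and half of the latter
absorbs it. In the remaining terms `g ≤ 1` is discarded. -/
lemma pointwise_source_bound {p lam k t X a₁ a₂ b₁ b₂ b₃ n₁ n₄ n₅ B g w : ℝ} (hp : 1 < p)
    (hlam : 0 < lam) (hk : 0 < k) (hkt : k < t) (hX : 0 ≤ X) (ha₁ : 0 ≤ a₁) (ha₂ : 0 ≤ a₂)
    (hb₁ : 0 ≤ b₁) (hb₂ : 0 ≤ b₂) (hb₃ : 0 ≤ b₃) (hn₁ : b₁ ≤ n₁) (hn₄ : a₂ ≤ n₄) (hn₅ : b₃ ≤ n₅)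
    (hB : |B| ≤ b₁ * X ^ (p - 1) + b₂ * |t| ^ (p - 1) + b₃) (hg0 : 0 ≤ g) (hg1 : g ≤ 1)
    (hw0 : 0 ≤ w) (hw : w ≤ g * (t - k)) :
    |B * w| + g * (a₁ * |t| ^ p + a₂) ≤ lam / 2 * (g * X ^ p) +
      levelSource p ((2 / lam) ^ (p - 1) * n₁ ^ p + (2 ^ p + 1) * n₅ + n₄) k (a₁ + b₂) t := by
  have ht : 0 < t := hk.trans hkt
  set v := t - k with hv
  have hv0 : 0 < v := sub_pos.2 hkt
  have htv : t = v + k := by rw [hv]; ring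
  rw [abs_of_pos ht] at hB ⊢
  set T := v ^ p + k ^ p with hT
  have hT0 : 0 ≤ T := by positivity
  have htp : t ^ p ≤ 2 ^ p * T := by
    rw [htv]
    exact add_rpow_le_two_rpow_mul hv0.le hk.le (by linarith)
  have htp0 : 0 ≤ t ^ p := by positivity
  have h1 : b₁ * v * X ^ (p - 1) ≤ lam / 2 * X ^ p + (2 / lam) ^ (p - 1) * n₁ ^ p * v ^ p := by
    refine (rpow_sub_one_mul_le hX (by positivity) hp hlam).trans ?_
    rw [Real.mul_rpow hb₁ hv0.le, mul_assoc _ (n₁ ^ p)]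
    gcongr
  have h2 : v * t ^ (p - 1) ≤ t ^ p := by
    calc v * t ^ (p - 1) ≤ t * t ^ (p - 1) := by gcongr; linarith
      _ = t ^ p := by
        rw [← Real.rpow_one_add' ht.le (by linarith)]
        ring_nf
  -- The term `b₃ * v` has lower homogeneity than `t ^ p`; this bound, like `a₂`, contributes to the
  -- inhomogeneous `1` in `levelSource`.
  have h3 : v ≤ 1 + t ^ p := by
    rcases le_total t 1 with h | h
    · linarith
    · linarith [Real.self_le_rpow_of_one_le h hp.le]
  have hc0 : 0 ≤ (2 / lam) ^ (p - 1) * n₁ ^ p := by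
    have : 0 ≤ n₁ := hb₁.trans hn₁
    positivity
  have hvT : v ^ p ≤ T := by
    rw [hT]
    linarith [Real.rpow_nonneg hk.le p]
  have h2p : (0 : ℝ) ≤ 2 ^ p := by positivity
  have hBw : |B * w| ≤ g * (b₁ * v * X ^ (p - 1) + b₂ * (v * t ^ (p - 1)) + b₃ * v) := by
    rw [abs_mul, abs_of_nonneg hw0]
    calc |B| * w ≤ (b₁ * X ^ (p - 1) + b₂ * t ^ (p - 1) + b₃) * (g * v) := by gcongr
      _ = _ := by ring
  have hin : b₁ * v * X ^ (p - 1) + b₂ * (v * t ^ (p - 1)) + b₃ * v + (a₁ * t ^ p + a₂) ≤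
      lam / 2 * X ^ p + (2 ^ p * (a₁ + b₂) * T +
        ((2 / lam) ^ (p - 1) * n₁ ^ p + (2 ^ p + 1) * n₅ + n₄) * (T + 1)) := by
    have e1 : b₂ * (v * t ^ (p - 1)) ≤ b₂ * (2 ^ p * T) :=
      mul_le_mul_of_nonneg_left (h2.trans htp) hb₂
    have e2 : a₁ * t ^ p ≤ a₁ * (2 ^ p * T) := by gcongr
    have e3 : b₃ * v ≤ n₅ * (1 + 2 ^ p * T) :=
      mul_le_mul hn₅ (h3.trans (by gcongr)) hv0.le (hb₃.trans hn₅)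
    have e4 : (2 / lam) ^ (p - 1) * n₁ ^ p * v ^ p ≤ (2 / lam) ^ (p - 1) * n₁ ^ p * (T + 1) := by
      gcongr
      linarith
    have e5 : 0 ≤ n₅ * (2 ^ p + T) := mul_nonneg (hb₃.trans hn₅) (by positivity)
    have e6 : 0 ≤ n₄ * T := mul_nonneg (ha₂.trans hn₄) hT0
    nlinarith
  have hS : 0 ≤ 2 ^ p * (a₁ + b₂) * T +
        ((2 / lam) ^ (p - 1) * n₁ ^ p + (2 ^ p + 1) * n₅ + n₄) * (T + 1) := by
    have := hb₃.trans hn₅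
    have := ha₂.trans hn₄
    positivity
  rw [levelSource, if_pos hkt]
  calc |B * w| + g * (a₁ * t ^ p + a₂) ≤ g * (b₁ * v * X ^ (p - 1) + b₂ * (v * t ^ (p - 1)) +
        b₃ * v + (a₁ * t ^ p + a₂)) := by
        linear_combination hBw
    _ ≤ g * (lam / 2 * X ^ p + (2 ^ p * (a₁ + b₂) * T +
        ((2 / lam) ^ (p - 1) * n₁ ^ p + (2 ^ p + 1) * n₅ + n₄) * (T + 1))) := by gcongr
    _ ≤ _ := by
      rw [mul_add]
      have := mul_le_of_le_one_left hS hg1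
      linarith

/-- The energy (Caccioppoli) inequality for smooth truncations of a subsolution. -/
theorem IsWeakSubsolution.lintegral_gradient_le {N : ℕ} {p lam : ℝ} (hp : 1 < p) (hpN : p < N)
    (hlam : 0 < lam) {Ω : Set (EuclideanSpace ℝ (Fin N))}
    {A : EuclideanSpace ℝ (Fin N) → ℝ → EuclideanSpace ℝ (Fin N) → EuclideanSpace ℝ (Fin N)}
    {B : EuclideanSpace ℝ (Fin N) → ℝ → EuclideanSpace ℝ (Fin N) → ℝ}
    {a₁ a₂ b₁ b₂ b₃ : EuclideanSpace ℝ (Fin N) → ℝ} {n₁ n₄ n₅ : ℝ}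
    (hB : IsCaratheodory Ω B)
    (hnn : ∀ᵐ x ∂(volume.restrict Ω), 0 ≤ a₁ x ∧ 0 ≤ a₂ x ∧ 0 ≤ b₁ x ∧ 0 ≤ b₂ x ∧ 0 ≤ b₃ x)
    (hSA : StructureA Ω p lam a₁ a₂ A) (hSB : StructureB Ω p b₁ b₂ b₃ B)
    (hn₁ : ∀ᵐ x ∂(volume.restrict Ω), b₁ x ≤ n₁) (hn₄ : ∀ᵐ x ∂(volume.restrict Ω), a₂ x ≤ n₄)
    (hn₅ : ∀ᵐ x ∂(volume.restrict Ω), b₃ x ≤ n₅) (hn₁0 : 0 ≤ n₁) (hn₄0 : 0 ≤ n₄) (hn₅0 : 0 ≤ n₅)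
    (ha₁m : AEStronglyMeasurable a₁ (volume.restrict Ω))
    (hb₂m : AEStronglyMeasurable b₂ (volume.restrict Ω))
    {u : EuclideanSpace ℝ (Fin N) → ℝ} {Du : EuclideanSpace ℝ (Fin N) → EuclideanSpace ℝ (Fin N)}
    (hu : IsWeakSubsolution Ω p A B u Du) {k h : ℝ} (hk : 0 < k) (hkh : k < h) :
    ∫⁻ x in Ω, ‖smoothRampSlope k h (u x) • Du x‖ₑ ^ p ≤ ENNReal.ofReal (2 / lam) *
      ∫⁻ x in Ω, ENNReal.ofReal (levelSource p
        ((2 / lam) ^ (p - 1) * n₁ ^ p + (2 ^ p + 1) * n₅ + n₄) k (a₁ x + b₂ x) (u x)) := by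
  set P := (2 / lam) ^ (p - 1) * n₁ ^ p + (2 ^ p + 1) * n₅ + n₄ with hP
  have hP0 : 0 ≤ P := by positivity
  set R := fun x => levelSource p P k (a₁ x + b₂ x) (u x) with hR
  have hum := hu.mem.1.1
  have hRm : AEStronglyMeasurable R (volume.restrict Ω) :=
    ((measurable_levelSource p P k).comp_aemeasurable
      ((ha₁m.add hb₂m).aemeasurable.prodMk hum.aemeasurable)).aestronglyMeasurable
  have hR0 : 0 ≤ᵐ[volume.restrict Ω] R := by
    filter_upwards [hnn] with x hx
    exact levelSource_nonneg hP0 hk (add_nonneg hx.1 hx.2.2.2.1)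
  -- If the right-hand side is infinite there is nothing to prove. Otherwise `R` is integrable and
  -- dominates `B w` together with the energy density, which makes `w` an admissible test function.
  by_cases hfin : ∫⁻ x in Ω, ENNReal.ofReal (R x) = ⊤
  · rw [hfin, ENNReal.mul_top (by simpa using by positivity)]
    exact le_top
  have hRi : Integrable R (volume.restrict Ω) := by
    refine ⟨hRm, ?_⟩
    rw [hasFiniteIntegral_iff_ofReal hR0]
    exact lt_top_iff_ne_top.2 hfin
  set g := fun x => smoothRampSlope k h (u x) with hg
  set w := fun x => smoothRamp k h (u x) with hw
  have hgm : AEStronglyMeasurable g (volume.restrict Ω) :=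
    smoothRamp.slope_continuous.comp_aestronglyMeasurable hum
  have hwm : AEStronglyMeasurable w (volume.restrict Ω) :=
    smoothRamp.contDiff.continuous.comp_aestronglyMeasurable hum
  have hEi : Integrable (fun x => g x * ‖Du x‖ ^ p) (volume.restrict Ω) := by
    have h1 : Integrable (fun x => ‖Du x‖ ^ p) (volume.restrict Ω) := by
      have := hu.mem.2.1.integrable_norm_rpow (by simp; linarith) ENNReal.ofReal_ne_top
      rwa [ENNReal.toReal_ofReal (by linarith)] at this
    refine h1.mono (hgm.mul h1.1) (Eventually.of_forall fun x => ?_)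
    rw [norm_mul]
    refine mul_le_of_le_one_left (norm_nonneg _) ?_
    rw [Real.norm_of_nonneg (smoothRamp.slope_nonneg _)]
    exact smoothRamp.slope_le_one _
  have hpt : ∀ᵐ x ∂(volume.restrict Ω), |B x (u x) (Du x) * w x| +
      g x * (a₁ x * |u x| ^ p + a₂ x) ≤ lam / 2 * (g x * ‖Du x‖ ^ p) + R x := by
    filter_upwards [hnn, hSB, hn₁, hn₄, hn₅, hR0] with x hx hBx h1 h4 h5 hRx
    rcases lt_or_ge k (u x) with hkx | hkx
    · exact pointwise_source_bound hp hlam hk hkx (norm_nonneg _) hx.1 hx.2.1 hx.2.2.1 hx.2.2.2.1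
        hx.2.2.2.2 h1 h4 h5 (hBx _ _) (smoothRamp.slope_nonneg _) (smoothRamp.slope_le_one _)
        (smoothRamp.nonneg hkh _) (smoothRamp.le_slope_mul hkh hkx.le)
    · have e1 : g x = 0 := smoothRamp.slope_eq_zero hkh hkx
      have e2 : w x = 0 := smoothRamp.eq_zero hkh hkx
      simpa [e1, e2] using hRx
  have hsumi : Integrable (fun x => lam / 2 * (g x * ‖Du x‖ ^ p) + R x) (volume.restrict Ω) :=
    (hEi.const_mul _).add hRi
  have hBw : IntegrableOn (fun x => B x (u x) (Du x) * w x) Ω := by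
    refine hsumi.mono' ((hB.aestronglyMeasurable_comp hum hu.mem.2.1.1).mul hwm) ?_
    filter_upwards [hpt, hnn] with x hx hx0
    have : 0 ≤ g x * (a₁ x * |u x| ^ p + a₂ x) :=
      mul_nonneg (smoothRamp.slope_nonneg _)
        (add_nonneg (mul_nonneg hx0.1 (by positivity)) hx0.2.1)
    rw [Real.norm_eq_abs]
    linarith
  have hmem : IsBeppoLevi Ω p w (fun x => g x • Du x) :=
    hu.mem.comp hp hpN smoothRamp.contDiff smoothRamp.hasDerivAt smoothRamp.slope_continuous
      (fun t => by
        rw [abs_of_nonneg (smoothRamp.slope_nonneg t)]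
        exact smoothRamp.slope_le_one t)
      (smoothRamp.eq_zero hkh hk.le)
  obtain ⟨hAi, hAB⟩ := hu.le w _ hmem
    (Eventually.of_forall fun x => smoothRamp.nonneg hkh _) hBw
  have hmain : lam / 2 * ∫ x in Ω, g x * ‖Du x‖ ^ p ≤ ∫ x in Ω, R x := by
    have hle : ∫ x in Ω, (lam / 2 * (g x * ‖Du x‖ ^ p) - R x) ≤
        ∫ x in Ω, (inner ℝ (A x (u x) (Du x)) (g x • Du x) - B x (u x) (Du x) * w x) := by
      refine integral_mono_ae ((hEi.const_mul _).sub hRi) (hAi.sub hBw) ?_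
      filter_upwards [hpt, hSA] with x hx hAx
      have h1 := mul_le_mul_of_nonneg_left (hAx (u x) (Du x))
        (smoothRamp.slope_nonneg (k := k) (h := h) (u x))
      have h2 := le_abs_self (B x (u x) (Du x) * w x)
      have h3 : inner ℝ (A x (u x) (Du x)) (g x • Du x) =
        g x * inner ℝ (A x (u x) (Du x)) (Du x) := real_inner_smul_right _ _ _
      simp only [h3]
      change g x * _ ≤ g x * _ at h1
      nlinarith
    rw [integral_sub (hEi.const_mul _) hRi, integral_const_mul, integral_sub hAi hBw] at hle
    linarith
  -- Testing controls `g |Du|^p`, whereas the gradient of `w` requires `g^p |Du|^p`; since `0 ≤ g ≤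
  -- 1` and `p > 1`, `g^p ≤ g`.
  calc ∫⁻ x in Ω, ‖g x • Du x‖ₑ ^ p ≤ ∫⁻ x in Ω, ENNReal.ofReal (g x * ‖Du x‖ ^ p) := by
        refine lintegral_mono fun x => ?_
        have hg0 : 0 ≤ g x := smoothRamp.slope_nonneg _
        have hg1 : g x ≤ 1 := smoothRamp.slope_le_one _
        rw [← ofReal_norm, ENNReal.ofReal_rpow_of_nonneg (norm_nonneg _) (by linarith), norm_smul,
          Real.norm_of_nonneg hg0, Real.mul_rpow hg0 (norm_nonneg _)]
        gcongr
        exact Real.rpow_le_self_of_le_one hg0 hg1 hp.le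
    _ = ENNReal.ofReal (∫ x in Ω, g x * ‖Du x‖ ^ p) :=
        (ofReal_integral_eq_lintegral_ofReal hEi (Eventually.of_forall fun x =>
          mul_nonneg (smoothRamp.slope_nonneg _) (by positivity))).symm
    _ ≤ ENNReal.ofReal (2 / lam * ∫ x in Ω, R x) := by
        gcongr
        rw [div_mul_eq_mul_div, le_div_iff₀ hlam]
        linarith
    _ = ENNReal.ofReal (2 / lam) * ∫⁻ x in Ω, ENNReal.ofReal (R x) := by
        rw [ENNReal.ofReal_mul (by positivity), ofReal_integral_eq_lintegral_ofReal hRi hR0]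

/-! ### From the energy to decay of the level sets. -/

/-- Monotone convergence as `l` decreases to `k`. It removes the upper end `h` of the ramp from the
estimates. -/
lemma lintegral_ofReal_sub_rpow_le {α : Type*} [MeasurableSpace α] {μ : Measure α} {u : α → ℝ}
    (hu : AEMeasurable u μ) {s k : ℝ} (hs : 0 < s) {M : ℝ≥0∞}
    (h : ∀ l, k < l → ∫⁻ x, ENNReal.ofReal (u x - l) ^ s ∂μ ≤ M) :
    ∫⁻ x, ENNReal.ofReal (u x - k) ^ s ∂μ ≤ M := by
  refine le_of_tendsto' (lintegral_tendsto_of_tendsto_of_monotone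
    (f := fun (n : ℕ) x => ENNReal.ofReal (u x - (k + 1 / ((n : ℝ) + 1))) ^ s) (fun n => ?_)
    (Eventually.of_forall fun x => ?_) (Eventually.of_forall fun x => ?_)) fun n => ?_
  · exact (hu.sub_const _).ennreal_ofReal.pow_const _
  · intro a b hab
    simp only
    gcongr
  · have h1 := (tendsto_one_div_add_atTop_nhds_zero_nat (𝕜 := ℝ)).const_add k
    rw [add_zero] at h1
    exact ((ENNReal.continuous_rpow_const.comp ENNReal.continuous_ofReal).tendsto _).comp
      (h1.const_sub (u x))
  · refine h _ ?_
    have : (0 : ℝ) < 1 / ((n : ℝ) + 1) := by positivity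
    linarith

/-- The energy inequality combined with the Sobolev inequality. -/
theorem level_sobolev_le {N : ℕ} {p : ℝ} (hp : 1 < p) (hpN : p < N) {S : ℝ≥0}
    {Ω : Set (EuclideanSpace ℝ (Fin N))}
    (hS : ∀ (u : EuclideanSpace ℝ (Fin N) → ℝ)
      (Du : EuclideanSpace ℝ (Fin N) → EuclideanSpace ℝ (Fin N)), IsBeppoLevi Ω p u Du →
      eLpNorm u (ENNReal.ofReal (sobolevExponent N p)) (volume.restrict Ω) ≤
        S * eLpNorm Du (ENNReal.ofReal p) (volume.restrict Ω))
    {u : EuclideanSpace ℝ (Fin N) → ℝ} {Du : EuclideanSpace ℝ (Fin N) → EuclideanSpace ℝ (Fin N)}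
    (hu : IsBeppoLevi Ω p u Du) {k : ℝ} (hk : 0 < k) {F : ℝ≥0∞}
    (hE : ∀ h, k < h → ∫⁻ x in Ω, ‖smoothRampSlope k h (u x) • Du x‖ₑ ^ p ≤ F) :
    (∫⁻ x in Ω, ENNReal.ofReal (u x - k) ^ sobolevExponent N p) ^ (p / sobolevExponent N p) ≤
      (S : ℝ≥0∞) ^ p * F := by
  have hp0 : 0 < p := by linarith
  have hs0 := sobolevExponent_pos hp hpN
  set s := sobolevExponent N p
  -- The bound is uniform in `h`, so `h` may tend to `k`. Positivity of `k` makes the ramp vanish at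
  -- the origin, as the chain rule requires.
  have key : ∀ h, k < h → ∫⁻ x in Ω, ENNReal.ofReal (u x - h) ^ s ≤
      ((S : ℝ≥0∞) ^ p * F) ^ (s / p) := by
    intro h hkh
    have hmem := hu.comp hp hpN smoothRamp.contDiff (smoothRamp.hasDerivAt (k := k) (h := h))
      smoothRamp.slope_continuous
      (fun t => by
        rw [abs_of_nonneg (smoothRamp.slope_nonneg t)]
        exact smoothRamp.slope_le_one t)
      (smoothRamp.eq_zero hkh hk.le)
    have h1 := hS _ _ hmem
    rw [eLpNorm_eq_lintegral_rpow_enorm_toReal (by simpa using hs0) ENNReal.ofReal_ne_top,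
      eLpNorm_eq_lintegral_rpow_enorm_toReal (by simpa using hp0) ENNReal.ofReal_ne_top,
      ENNReal.toReal_ofReal hs0.le, ENNReal.toReal_ofReal hp0.le] at h1
    have h2 : ∫⁻ x in Ω, ENNReal.ofReal (u x - h) ^ s ≤
        ∫⁻ x in Ω, ‖smoothRamp k h (u x)‖ₑ ^ s := by
      refine lintegral_mono fun x => ?_
      gcongr
      rw [Real.enorm_of_nonneg (smoothRamp.nonneg hkh _)]
      exact ENNReal.ofReal_le_ofReal (smoothRamp.sub_le hkh _)
    have h3 := ENNReal.rpow_le_rpow h1 hs0.le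
    rw [← ENNReal.rpow_mul, one_div_mul_cancel hs0.ne', ENNReal.rpow_one] at h3
    refine (h2.trans h3).trans ?_
    have e1 : ((S : ℝ≥0∞) ^ p * F) ^ (s / p) = ((S : ℝ≥0∞) * F ^ (1 / p)) ^ s := by
      rw [ENNReal.mul_rpow_of_nonneg _ _ (by positivity),
        ENNReal.mul_rpow_of_nonneg _ _ (by positivity), ← ENNReal.rpow_mul, ← ENNReal.rpow_mul]
      congr 2 <;> field_simp
    rw [e1]
    gcongr
    exact hE h hkh
  have h4 := ENNReal.rpow_le_rpow (lintegral_ofReal_sub_rpow_le hu.1.1.aemeasurable hs0 key)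
    (show 0 ≤ p / s by positivity)
  rwa [← ENNReal.rpow_mul, show s / p * (p / s) = 1 by field_simp, ENNReal.rpow_one] at h4

/-- Hölder's inequality for two functions on a set off which the second one vanishes. -/
lemma lintegral_rpow_mul_rpow_le {α : Type*} [MeasurableSpace α] {μ : Measure α} {f v : α → ℝ≥0∞}
    {T : Set α} (hf : AEMeasurable f μ) (hv : AEMeasurable v μ) (hT : NullMeasurableSet T μ)
    (hvT : ∀ x ∉ T, v x = 0) {a b c : ℝ} (ha : 0 ≤ a) (hb : 0 < b) (hc : 0 ≤ c)
    (habc : a + b + c = 1) :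
    ∫⁻ x, f x ^ a * v x ^ b ∂μ ≤
      (∫⁻ x, f x ∂μ) ^ a * (∫⁻ x, v x ∂μ) ^ b * μ T ^ c := by
  -- The indicator of `T` is the third Hölder factor; inserting it is harmless because `v ^ b`
  -- vanishes off `T` when `b > 0`.
  have hind : AEMeasurable (T.indicator fun _ => (1 : ℝ≥0∞)) μ :=
    aemeasurable_const.indicator₀ hT
  have h := ENNReal.lintegral_prod_norm_pow_le (μ := μ) (Finset.univ : Finset (Fin 3))
    (f := ![f, v, T.indicator fun _ => 1]) (p := ![a, b, c])
    (by intro i _; fin_cases i <;> assumption) (by simpa [Fin.sum_univ_three] using habc)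
    (by intro i _; fin_cases i; exacts [ha, hb.le, hc])
  simp only [Fin.prod_univ_three] at h
  simp only [Matrix.cons_val_zero, Matrix.cons_val_one, Matrix.cons_val] at h
  rw [show ∫⁻ x, T.indicator (fun _ => (1 : ℝ≥0∞)) x ∂μ = μ T from
    lintegral_indicator_one₀ hT] at h
  refine (lintegral_mono fun x => ?_).trans h
  by_cases hx : x ∈ T
  · simp [hx]
  · simp [hvT x hx, ENNReal.zero_rpow_of_pos hb]

/-- Expanding the source gives products of `d` or a constant with `(u - k)^p` or a constant.
Hölder's inequality puts `d` in `L^(1/a)` and `(u - k)^+` in `L^s`, with the indicator of the level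
set filling the remaining exponents. -/
lemma lintegral_levelSource_le {α : Type*} [MeasurableSpace α] {μ : Measure α} {u d : α → ℝ}
    (hu : AEMeasurable u μ) (hd : AEMeasurable d μ) (hd0 : ∀ᵐ x ∂μ, 0 ≤ d x)
    {p P k s a b δ₁ δ₂ : ℝ} (hp : 0 < p) (hP : 0 ≤ P) (hk : 0 < k) (ha : 0 < a) (hb : 0 < b)
    (hδ₁ : 0 < δ₁) (hδ : δ₁ ≤ δ₂) (hab : a + b + δ₁ = 1) (hb2 : b + δ₂ = 1) (hsb : s * b = p)
    (hm : μ {x | k < u x} ≤ 1) :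
    ∫⁻ x, ENNReal.ofReal (levelSource p P k (d x) (u x)) ∂μ ≤
      (ENNReal.ofReal (2 ^ p) * (∫⁻ x, ENNReal.ofReal (d x) ^ (1 / a) ∂μ) ^ a +
        ENNReal.ofReal P) *
      ((∫⁻ x, ENNReal.ofReal (u x - k) ^ s ∂μ) ^ b * μ {x | k < u x} ^ δ₁ +
        μ {x | k < u x} ^ b * (ENNReal.ofReal (k ^ p) * μ {x | k < u x} ^ δ₁ +
          μ {x | k < u x} ^ δ₂)) := by
  set T := {x | k < u x} with hTdef
  have hT : NullMeasurableSet T μ := nullMeasurableSet_lt aemeasurable_const hu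
  set D := fun x => ENNReal.ofReal (d x) ^ (1 / a) with hD
  set v := fun x => ENNReal.ofReal (u x - k) ^ s with hv
  set e : α → ℝ≥0∞ := T.indicator fun _ => 1 with he
  have hDm : AEMeasurable D μ := hd.ennreal_ofReal.pow_const _
  have hvm : AEMeasurable v μ := (hu.sub_const _).ennreal_ofReal.pow_const _
  have hem : AEMeasurable e μ := aemeasurable_const.indicator₀ hT
  have hs : 0 < s := by
    by_contra hs
    nlinarith
  have hvT : ∀ x ∉ T, v x = 0 := fun x hx => by
    have : u x - k ≤ 0 := by
      simp only [hTdef, Set.mem_ofPred_eq, not_lt] at hx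
      linarith
    simp [hv, ENNReal.ofReal_of_nonpos this, ENNReal.zero_rpow_of_pos hs]
  have heT : ∀ x ∉ T, e x = 0 := fun x hx => by simp [he, hx]
  have heI : ∫⁻ x, e x ∂μ = μ T := lintegral_indicator_one₀ hT
  have i1 := lintegral_rpow_mul_rpow_le hDm hvm hT hvT ha.le hb hδ₁.le hab
  have i2 := lintegral_rpow_mul_rpow_le hDm hem hT heT ha.le hb hδ₁.le hab
  have i3 := lintegral_rpow_mul_rpow_le (f := e) (c := 0) hem hvm hT hvT
    (hδ₁.le.trans hδ) hb le_rfl (by linarith)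
  have i4 := lintegral_rpow_mul_rpow_le (f := e) (c := 0) hem hem hT heT
    (hδ₁.le.trans hδ) hb le_rfl (by linarith)
  rw [heI] at i2 i3 i4
  rw [ENNReal.rpow_zero, mul_one] at i3 i4
  -- As the level set has measure at most one, `δ₂` may be lowered to `δ₁` wherever convenient; the
  -- inhomogeneous term keeps `δ₂`.
  have hmδ : μ T ^ δ₂ ≤ μ T ^ δ₁ := ENNReal.rpow_le_rpow_of_exponent_ge hm hδ
  have hpt : ∀ᵐ x ∂μ, ENNReal.ofReal (levelSource p P k (d x) (u x)) ≤
      ENNReal.ofReal (2 ^ p) * (D x ^ a * v x ^ b) +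
      ENNReal.ofReal (2 ^ p) * ENNReal.ofReal (k ^ p) * (D x ^ a * e x ^ b) +
      ENNReal.ofReal P * (e x ^ δ₂ * v x ^ b) +
      (ENNReal.ofReal P * ENNReal.ofReal (k ^ p) + ENNReal.ofReal P) * (e x ^ δ₂ * e x ^ b) := by
    filter_upwards [hd0] with x hdx
    by_cases hx : k < u x
    · have hx0 : 0 < u x - k := sub_pos.2 hx
      have e1 : D x ^ a = ENNReal.ofReal (d x) := by
        simp only [hD]
        rw [← ENNReal.rpow_mul, one_div_mul_cancel ha.ne', ENNReal.rpow_one]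
      have e2 : v x ^ b = ENNReal.ofReal ((u x - k) ^ p) := by
        simp only [hv]
        rw [← ENNReal.rpow_mul, hsb, ENNReal.ofReal_rpow_of_pos hx0]
      have e3 : e x = 1 := by simp [he, hTdef, hx]
      have g1 : 0 ≤ (u x - k) ^ p := by positivity
      have g2 : 0 ≤ k ^ p := by positivity
      rw [e1, e2, e3, levelSource, if_pos hx]
      simp only [ENNReal.one_rpow, mul_one, one_mul]
      rw [ENNReal.ofReal_add (by positivity) (by positivity), ENNReal.ofReal_mul (by positivity),
        ENNReal.ofReal_mul (by positivity), ENNReal.ofReal_mul hP,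
        ENNReal.ofReal_add (by positivity) zero_le_one, ENNReal.ofReal_add g1 g2,
        ENNReal.ofReal_one]
      apply le_of_eq
      ring
    · rw [levelSource, if_neg hx]
      simp
  have m1 : AEMeasurable (fun x => D x ^ a * v x ^ b) μ :=
    (hDm.pow_const _).mul (hvm.pow_const _)
  have m2 : AEMeasurable (fun x => D x ^ a * e x ^ b) μ :=
    (hDm.pow_const _).mul (hem.pow_const _)
  have m3 : AEMeasurable (fun x => e x ^ δ₂ * v x ^ b) μ :=
    (hem.pow_const _).mul (hvm.pow_const _)
  have m4 : AEMeasurable (fun x => e x ^ δ₂ * e x ^ b) μ :=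
    (hem.pow_const _).mul (hem.pow_const _)
  refine (lintegral_mono_ae hpt).trans ?_
  rw [lintegral_add_right' _ (m4.const_mul _), lintegral_add_right' _ (m3.const_mul _),
    lintegral_add_right' _ (m2.const_mul _), lintegral_const_mul'' _ m1, lintegral_const_mul'' _ m2,
    lintegral_const_mul'' _ m3, lintegral_const_mul'' _ m4]
  set c := ENNReal.ofReal (2 ^ p)
  set κ := ENNReal.ofReal (k ^ p)
  set P' := ENNReal.ofReal P
  set Q := (∫⁻ x, D x ∂μ) ^ a
  set X := (∫⁻ x, v x ∂μ) ^ b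
  calc _ ≤ c * (Q * X * μ T ^ δ₁) + c * κ * (Q * μ T ^ b * μ T ^ δ₁) + P' * (μ T ^ δ₂ * X) +
        (P' * κ + P') * (μ T ^ δ₂ * μ T ^ b) := by gcongr
    _ = c * Q * (X * μ T ^ δ₁ + μ T ^ b * (κ * μ T ^ δ₁)) +
        P' * (X * μ T ^ δ₂ + μ T ^ b * (κ * μ T ^ δ₂ + μ T ^ δ₂)) := by ring
    _ ≤ c * Q * (X * μ T ^ δ₁ + μ T ^ b * (κ * μ T ^ δ₁ + μ T ^ δ₂)) +
        P' * (X * μ T ^ δ₁ + μ T ^ b * (κ * μ T ^ δ₁ + μ T ^ δ₂)) := by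
      gcongr
      exact le_self_add
    _ = _ := by ring

/-- Decay of the measure of the superlevel sets, once the term containing the unknown is absorbed
into the left-hand side. -/
theorem level_decay {α : Type*} [MeasurableSpace α] {μ : Measure α} {u d : α → ℝ}
    (hu : AEMeasurable u μ) (hd : AEMeasurable d μ) (hd0 : ∀ᵐ x ∂μ, 0 ≤ d x)
    {p P k l s a b δ₁ δ₂ Γ Q : ℝ} (hp : 0 < p) (hP : 0 ≤ P) (hΓ : 0 ≤ Γ) (hQ0 : 0 ≤ Q)
    (hk : 0 < k) (hkl : k < l) (ha : 0 < a) (hb : 0 < b)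
    (hδ₁ : 0 < δ₁) (hδ : δ₁ ≤ δ₂) (hab : a + b + δ₁ = 1) (hb2 : b + δ₂ = 1) (hsb : s * b = p)
    (hQ : (∫⁻ x, ENNReal.ofReal (d x) ^ (1 / a) ∂μ) ^ a ≤ ENNReal.ofReal Q)
    (hfin : ∫⁻ x, ENNReal.ofReal (u x - k) ^ s ∂μ ≠ ⊤)
    (hE : (∫⁻ x, ENNReal.ofReal (u x - k) ^ s ∂μ) ^ b ≤
      ENNReal.ofReal Γ * ∫⁻ x, ENNReal.ofReal (levelSource p P k (d x) (u x)) ∂μ)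
    (hmfin : μ {x | k < u x} ≠ ⊤) (hm : μ.real {x | k < u x} ≤ 1)
    (hsmall : Γ * (2 ^ p * Q + P) * μ.real {x | k < u x} ^ δ₁ ≤ 1 / 2) :
    (l - k) ^ p * μ.real {x | l < u x} ^ b ≤ 2 * (Γ * (2 ^ p * Q + P)) *
      (μ.real {x | k < u x} ^ b *
        (k ^ p * μ.real {x | k < u x} ^ δ₁ + μ.real {x | k < u x} ^ δ₂)) := by
  have hs : 0 < s := by
    by_contra hs
    nlinarith
  set m := μ.real {x | k < u x} with hmdef
  have hm0 : 0 ≤ m := measureReal_nonneg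
  have hmu : μ {x | k < u x} = ENNReal.ofReal m := (ofReal_measureReal hmfin).symm
  set V := ∫⁻ x, ENNReal.ofReal (u x - k) ^ s ∂μ with hV
  set X := (V ^ b).toReal with hX
  have hVX : V ^ b = ENNReal.ofReal X :=
    (ENNReal.ofReal_toReal (ENNReal.rpow_ne_top_of_nonneg hb.le hfin)).symm
  have hX0 : 0 ≤ X := ENNReal.toReal_nonneg
  set H := Γ * (2 ^ p * Q + P) with hH
  have hH0 : 0 ≤ H := by positivity
  have h1 : X ≤ H * (X * m ^ δ₁ + m ^ b * (k ^ p * m ^ δ₁ + m ^ δ₂)) := by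
    have h := hE.trans (mul_le_mul_right (lintegral_levelSource_le hu hd hd0 hp hP hk ha hb hδ₁ hδ
      hab hb2 hsb (by rw [hmu]; simpa using ENNReal.ofReal_le_ofReal hm)) _)
    rw [← hV, hVX, hmu, ENNReal.ofReal_rpow_of_nonneg hm0 hδ₁.le,
      ENNReal.ofReal_rpow_of_nonneg hm0 hb.le,
      ENNReal.ofReal_rpow_of_nonneg hm0 (hδ₁.le.trans hδ)] at h
    have h' := h.trans (mul_le_mul_right (mul_le_mul_left (add_le_add_left
      (mul_le_mul_right hQ _) _) _) _)
    rw [← ENNReal.ofReal_mul (by positivity), ← ENNReal.ofReal_add (by positivity) hP,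
      ← ENNReal.ofReal_mul hX0, ← ENNReal.ofReal_mul (by positivity),
      ← ENNReal.ofReal_add (by positivity) (by positivity), ← ENNReal.ofReal_mul (by positivity),
      ← ENNReal.ofReal_add (by positivity) (by positivity), ← ENNReal.ofReal_mul (by positivity),
      ← ENNReal.ofReal_mul hΓ, ENNReal.ofReal_le_ofReal_iff (by positivity)] at h'
    rwa [hH, mul_assoc]
  -- By `hsmall` the term `H * X * m ^ δ₁` is at most `X / 2`. It can be subtracted because `X`
  -- stands for a finite integral.
  have h2 : X ≤ 2 * H * (m ^ b * (k ^ p * m ^ δ₁ + m ^ δ₂)) := by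
    have := mul_le_mul_of_nonneg_right hsmall hX0
    nlinarith
  refine le_trans ?_ h2
  have hkl0 : 0 < l - k := sub_pos.2 hkl
  have hsub : {x | l < u x} ⊆ {x | k < u x} := fun x hx => hkl.trans hx
  have hlfin : μ {x | l < u x} ≠ ⊤ := ne_top_of_le_ne_top hmfin (measure_mono hsub)
  -- Chebyshev's inequality: `u - k > l - k` on the higher level set.
  have h3 : ENNReal.ofReal (l - k) ^ s * μ {x | l < u x} ≤ V := by
    refine le_trans ?_ (mul_meas_ge_le_lintegral₀
      ((hu.sub_const k).ennreal_ofReal.pow_const s) (ENNReal.ofReal (l - k) ^ s))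
    gcongr with x
    intro hx
    exact ENNReal.rpow_le_rpow (ENNReal.ofReal_le_ofReal (by linarith [Set.mem_ofPred.1 hx])) hs.le
  have h4 := ENNReal.rpow_le_rpow h3 hb.le
  rw [hVX, ENNReal.mul_rpow_of_nonneg _ _ hb.le, ← ENNReal.rpow_mul, hsb,
    ← ofReal_measureReal hlfin, ENNReal.ofReal_rpow_of_pos hkl0,
    ENNReal.ofReal_rpow_of_nonneg measureReal_nonneg hb.le, ← ENNReal.ofReal_mul (by positivity),
    ENNReal.ofReal_le_ofReal_iff hX0] at h4
  exact h4

/-! ### De Giorgi iteration and choice of the starting level. -/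

/-- De Giorgi's iteration: a nonnegative quantity decaying superlinearly between levels
vanishes at the level `2 * K` if it is small at the level `K`. -/
theorem deGiorgi_iteration {m : ℝ → ℝ} (hm0 : ∀ k, 0 ≤ m k) (hanti : ∀ k l, 0 < k → k ≤ l → m l ≤ m k)
    {p b δ₁ δ₂ H K M r : ℝ} (hp : 0 < p) (hb : 0 < b) (hδ₁ : 0 < δ₁) (hδ : δ₁ ≤ δ₂)
    (hH : 0 ≤ H) (hK : 0 < K) (hr : r = 2 ^ (-p / δ₁))
    (hrec : ∀ k l, 0 < k → k < l → m k ≤ 1 → H * m k ^ δ₁ ≤ 1 / 2 →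
      (l - k) ^ p * m l ^ b ≤ 2 * H * (m k ^ b * (k ^ p * m k ^ δ₁ + m k ^ δ₂)))
    (hmK : m K ≤ M) (hM1 : M ≤ 1) (hM : H * M ^ δ₁ ≤ r ^ b / (4 * 4 ^ p))
    (hMK : H * M ^ δ₂ ≤ r ^ b / (4 * 4 ^ p) * K ^ p) : m (2 * K) = 0 := by
  have hM0 : 0 ≤ M := (hm0 K).trans hmK
  have hr0 : 0 < r := by rw [hr]; positivity
  have hr1 : r < 1 := by
    rw [hr]
    exact Real.rpow_lt_one_of_one_lt_of_neg one_lt_two (div_neg_of_neg_of_pos (by linarith) hδ₁)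
  set t : ℝ := 2 ^ p with ht
  have ht0 : 0 < t := by positivity
  have h4 : (4 : ℝ) ^ p = t * t := by
    rw [ht, ← Real.mul_rpow (by norm_num) (by norm_num)]
    norm_num
  have ht1 : 1 ≤ t := Real.one_le_rpow one_le_two hp.le
  have hrb1 : r ^ b ≤ 1 := Real.rpow_le_one hr0.le hr1.le hb.le
  have hrδ : r ^ δ₁ = t⁻¹ := by
    rw [hr, ← Real.rpow_mul (by norm_num), div_mul_cancel₀ _ hδ₁.ne', Real.rpow_neg (by norm_num)]
  rw [h4] at hM hMK
  -- Geometric decay along levels increasing to `2 * K`. The ratio `r` satisfies `r ^ δ₁ = 2 ^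
  -- (-p)`, so the gain in `m k ^ δ₁` offsets the shrinking gaps `(l - k) ^ p`.
  have hstep : ∀ j : ℕ, m (K * (2 - (1 / 2) ^ j)) ≤ M * r ^ j := by
    intro j
    induction j with
    | zero => simpa [show (2 : ℝ) - 1 = 1 by norm_num] using hmK
    | succ j ih =>
      set k := K * (2 - (1 / 2) ^ j) with hk
      set l := K * (2 - (1 / 2) ^ (j + 1)) with hl
      have hpow : (0 : ℝ) < (1 / 2) ^ j := by positivity
      have hpow1 : (1 / 2 : ℝ) ^ j ≤ 1 := pow_le_one₀ (by norm_num) (by norm_num)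
      have hk0 : 0 < k := mul_pos hK (by linarith)
      have hlk : l - k = K * (1 / 2) ^ (j + 1) := by rw [hk, hl, pow_succ]; ring
      have hkl : k < l := by
        have : 0 < l - k := by rw [hlk]; positivity
        linarith
      have hk2 : k ≤ 2 * K := by rw [hk]; nlinarith
      have hrj1 : r ^ j ≤ 1 := pow_le_one₀ hr0.le hr1.le
      have hmM : m k ≤ M := ih.trans (mul_le_of_le_one_right hM0 hrj1)
      have hsmall : H * m k ^ δ₁ ≤ 1 / 2 := by
        calc H * m k ^ δ₁ ≤ H * M ^ δ₁ := by gcongr; exact hm0 k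
          _ ≤ r ^ b / (4 * (t * t)) := hM
          _ ≤ 1 / 2 := by
            rw [div_le_iff₀ (by positivity)]
            nlinarith
      have h := hrec k l hk0 hkl (hmM.trans hM1) hsmall
      have hrjδ : (r ^ j) ^ δ₁ = (t ^ j)⁻¹ := by
        rw [← Real.rpow_natCast, ← Real.rpow_mul hr0.le, mul_comm, Real.rpow_mul hr0.le, hrδ,
          Real.rpow_natCast, inv_pow]
      have hd1 : m k ^ δ₁ ≤ M ^ δ₁ * (t ^ j)⁻¹ := by
        rw [← hrjδ, ← Real.mul_rpow hM0 (by positivity)]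
        exact Real.rpow_le_rpow (hm0 k) ih hδ₁.le
      have hd2 : m k ^ δ₂ ≤ M ^ δ₂ * (t ^ j)⁻¹ := by
        calc m k ^ δ₂ ≤ (M * r ^ j) ^ δ₂ := Real.rpow_le_rpow (hm0 k) ih (hδ₁.le.trans hδ)
          _ = M ^ δ₂ * (r ^ j) ^ δ₂ := Real.mul_rpow hM0 (by positivity)
          _ ≤ M ^ δ₂ * (r ^ j) ^ δ₁ := mul_le_mul_of_nonneg_left
            (Real.rpow_le_rpow_of_exponent_ge (by positivity) hrj1 hδ) (by positivity)
          _ = _ := by rw [hrjδ]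
      have hkp : k ^ p ≤ t * K ^ p := by
        rw [ht, ← Real.mul_rpow (by norm_num) hK.le]
        exact Real.rpow_le_rpow hk0.le hk2 hp.le
      have hlkp : (l - k) ^ p = K ^ p * (t ^ (j + 1))⁻¹ := by
        rw [hlk, Real.mul_rpow hK.le (by positivity), ← Real.rpow_natCast (1 / 2),
          ← Real.rpow_mul (by norm_num), mul_comm _ p, Real.rpow_mul (by norm_num),
          Real.rpow_natCast, one_div, Real.inv_rpow (by norm_num), inv_pow]
      have hmkb : 0 ≤ m k ^ b := Real.rpow_nonneg (hm0 k) b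
      have hKp : 0 < K ^ p := by positivity
      have hMδ : 0 ≤ M ^ δ₁ := by positivity
      -- In the threshold `r ^ b / (4 * 4 ^ p)`, the `4` pays for the factor `2` of the recursion
      -- and for its two terms; `4 ^ p = t * t` pays for `k ≤ 2 * K` and for the extra half in `l -
      -- k`.
      have hmain : K ^ p * (t ^ (j + 1))⁻¹ * m l ^ b ≤
          K ^ p * (t ^ (j + 1))⁻¹ * (r ^ b * m k ^ b) := by
        calc K ^ p * (t ^ (j + 1))⁻¹ * m l ^ b
            ≤ 2 * H * (m k ^ b * (t * K ^ p * (M ^ δ₁ * (t ^ j)⁻¹) + M ^ δ₂ * (t ^ j)⁻¹)) := by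
              rw [← hlkp]
              refine h.trans ?_
              gcongr
              exact Real.rpow_nonneg (hm0 k) _
          _ = 2 * m k ^ b * (t ^ j)⁻¹ * (t * K ^ p * (H * M ^ δ₁) + H * M ^ δ₂) := by ring
          _ ≤ 2 * m k ^ b * (t ^ j)⁻¹ * (t * K ^ p * (r ^ b / (4 * (t * t))) +
                t * (r ^ b / (4 * (t * t)) * K ^ p)) := by
              exact mul_le_mul_of_nonneg_left (add_le_add (by gcongr)
                (hMK.trans (le_mul_of_one_le_left (by positivity) ht1))) (by positivity)
          _ = _ := by
              rw [pow_succ]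
              field_simp
              ring
      have hmlb : m l ^ b ≤ (r * m k) ^ b := by
        rw [Real.mul_rpow hr0.le (hm0 k)]
        exact le_of_mul_le_mul_left hmain (by positivity)
      have := (Real.rpow_le_rpow_iff (hm0 l) (mul_nonneg hr0.le (hm0 k)) hb).1 hmlb
      calc m l ≤ r * m k := this
        _ ≤ r * (M * r ^ j) := by gcongr
        _ = M * r ^ (j + 1) := by ring
  have hlim : Tendsto (fun j : ℕ => M * r ^ j) atTop (𝓝 0) := by
    simpa using (tendsto_pow_atTop_nhds_zero_of_lt_one hr0.le hr1).const_mul M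
  refine le_antisymm (ge_of_tendsto' hlim fun j => (hanti _ _ ?_ ?_).trans (hstep j)) (hm0 _)
  · have : (1 / 2 : ℝ) ^ j ≤ 1 := pow_le_one₀ (by norm_num) (by norm_num)
    exact mul_pos hK (by linarith)
  · have : (0 : ℝ) < (1 / 2) ^ j := by positivity
    nlinarith

/-- The starting level for the iteration. -/
lemma exists_starting_level {p n β δ₁ c L σ : ℝ} (hp : 0 < p) (hn : 0 < n) (hβ : 0 < β)
    (hδ₁ : 0 < δ₁) (hc0 : 0 < c) (hc1 : c ≤ 1) (hσ : 0 < σ)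
    (hL : L = (1 / c) ^ (1 / (β * δ₁) + 1 / (p + β * p / n))) {K : ℝ}
    (hK : K = L * max (σ ^ (β / (β + n))) σ) :
    0 < K ∧ (σ / K) ^ β ≤ 1 ∧ ((σ / K) ^ β) ^ δ₁ ≤ c ∧ ((σ / K) ^ β) ^ (p / n) ≤ c * K ^ p := by
  have hc1' : 1 ≤ 1 / c := by rwa [one_le_div hc0]
  have hL1 : 1 ≤ L := by
    rw [hL]
    exact Real.one_le_rpow hc1' (by positivity)
  have hL0 : 0 < L := by linarith
  have hmax : 0 < max (σ ^ (β / (β + n))) σ := lt_max_of_lt_right hσ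
  have hK0 : 0 < K := by rw [hK]; positivity
  -- The exponent in `L` is a sum of two reciprocals, so `L ^ y ≥ 1 / c` for both values of `y`
  -- needed below.
  have hLpow : ∀ y, 0 < y → 1 ≤ (1 / (β * δ₁) + 1 / (p + β * p / n)) * y → 1 / c ≤ L ^ y := by
    intro y _ hy
    rw [hL, ← Real.rpow_mul (by positivity)]
    exact Real.self_le_rpow_of_one_le hc1' hy
  have hσK : σ / K ≤ 1 / L := by
    rw [div_le_div_iff₀ hK0 hL0, one_mul, mul_comm, hK]
    gcongr
    exact le_max_right _ _
  have hσK0 : 0 ≤ σ / K := by positivity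
  refine ⟨hK0, ?_, ?_, ?_⟩
  · exact Real.rpow_le_one hσK0 (hσK.trans ((div_le_one hL0).2 hL1)) hβ.le
  · rw [← Real.rpow_mul hσK0]
    calc (σ / K) ^ (β * δ₁) ≤ (1 / L) ^ (β * δ₁) := by gcongr
      _ = 1 / L ^ (β * δ₁) := by rw [Real.div_rpow zero_le_one hL0.le, Real.one_rpow]
      _ ≤ c := by
        rw [one_div_le (by positivity) hc0]
        refine hLpow _ (by positivity) ?_
        rw [add_mul, one_div_mul_cancel (by positivity)]
        exact le_add_of_nonneg_right (by positivity)
  · rw [← Real.rpow_mul hσK0, Real.div_rpow hσ.le hK0.le, div_le_iff₀ (by positivity), mul_assoc,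
      ← Real.rpow_add hK0]
    have h1 : L * σ ^ (β / (β + n)) ≤ K := by
      rw [hK]
      gcongr
      exact le_max_left _ _
    have h2 : 1 / c ≤ L ^ (p + β * p / n) := by
      refine hLpow _ (by positivity) ?_
      rw [add_mul, one_div_mul_cancel (by positivity)]
      exact le_add_of_nonneg_left (by positivity)
    have h3 : (L * σ ^ (β / (β + n))) ^ (p + β * p / n) ≤ K ^ (p + β * p / n) :=
      Real.rpow_le_rpow (by positivity) h1 (by positivity)
    -- This identity determines the exponent: the powers of `σ` in the last smallness condition
    -- match exactly.
    have e1 : β / (β + n) * (p + β * p / n) = β * (p / n) := by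
      field_simp
      ring
    rw [Real.mul_rpow hL0.le (by positivity), ← Real.rpow_mul hσ.le, e1] at h3
    have e2 : p + β * (p / n) = p + β * p / n := by ring
    rw [e2]
    calc σ ^ (β * (p / n)) = c * (1 / c * σ ^ (β * (p / n))) := by field_simp
      _ ≤ c * (L ^ (p + β * p / n) * σ ^ (β * (p / n))) := by gcongr
      _ ≤ c * K ^ (p + β * p / n) := by gcongr

/-! ### Constants and norms of the data. -/

/-- The coefficient of the lower order terms in the energy inequality, as a function of the norms
of the coefficients of the equation. -/
noncomputable def energyConst (p lam S : ℝ) (n : ℝ≥0 × ℝ≥0 × ℝ≥0 × ℝ≥0 × ℝ≥0) : ℝ :=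
  S ^ p * (2 / lam) * (2 ^ p * ((n.2.1 : ℝ) + n.2.2.1) +
    ((2 / lam) ^ (p - 1) * (n.1 : ℝ) ^ p + (2 ^ p + 1) * n.2.2.2.2 + n.2.2.2.1))

lemma energyConst_nonneg {p lam S : ℝ} (hlam : 0 < lam) (hS : 0 ≤ S)
    (n : ℝ≥0 × ℝ≥0 × ℝ≥0 × ℝ≥0 × ℝ≥0) : 0 ≤ energyConst p lam S n := by
  unfold energyConst
  positivity

lemma energyConst_mono {p lam S : ℝ} (hp : 0 < p) (hlam : 0 < lam) (hS : 0 ≤ S) :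
    Monotone (energyConst p lam S) := by
  rintro ⟨n₁, n₂, n₃, n₄, n₅⟩ ⟨m₁, m₂, m₃, m₄, m₅⟩ ⟨h₁, h₂, h₃, h₄, h₅⟩
  simp only at h₁ h₂ h₃ h₄ h₅
  simp only [energyConst]
  gcongr

/-- The factor in the final estimate, in terms of the constant of the energy inequality. -/
noncomputable def supConst (c τ H : ℝ) : ℝ≥0 := Real.toNNReal (2 * (1 / (c / (H + 1))) ^ τ)

lemma supConst_mono {c τ a b : ℝ} (hc : 0 < c) (hτ : 0 ≤ τ) (ha : 0 ≤ a) (hab : a ≤ b) :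
    supConst c τ a ≤ supConst c τ b := by
  unfold supConst
  refine Real.toNNReal_mono ?_
  have hb : 0 < c / (b + 1) := div_pos hc (by linarith)
  gcongr

/-- Chebyshev's inequality for the positive part. It ties the level sets to the `L^β` norm and gives
them finite measure. -/
lemma measureReal_superlevel_le {α : Type*} [MeasurableSpace α] {μ : Measure α} {u : α → ℝ}
    {β k : ℝ} (hβ : 0 < β) (hk : 0 < k)
    (hu : MemLp (fun x => max (u x) 0) (ENNReal.ofReal β) μ) :
    μ {x | k < u x} ≠ ⊤ ∧ μ.real {x | k < u x} ≤
      ((eLpNorm (fun x => max (u x) 0) (ENNReal.ofReal β) μ).toReal / k) ^ β := by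
  have h := mul_meas_ge_le_pow_eLpNorm' μ (p := ENNReal.ofReal β) (by simpa using hβ)
    ENNReal.ofReal_ne_top hu.1 (ENNReal.ofReal k)
  rw [ENNReal.toReal_ofReal hβ.le, ← ENNReal.ofReal_toReal hu.eLpNorm_ne_top,
    ENNReal.ofReal_rpow_of_pos hk, ENNReal.ofReal_rpow_of_nonneg ENNReal.toReal_nonneg hβ.le] at h
  set σ := (eLpNorm (fun x => max (u x) 0) (ENNReal.ofReal β) μ).toReal with hσ
  have hσ0 : 0 ≤ σ := ENNReal.toReal_nonneg
  have hsub : {x | k < u x} ⊆ {x | ENNReal.ofReal k ≤ ‖max (u x) 0‖ₑ} := fun x hx => by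
    change ENNReal.ofReal k ≤ ‖max (u x) 0‖ₑ
    rw [Real.enorm_of_nonneg (le_max_right _ _)]
    exact ENNReal.ofReal_le_ofReal ((le_of_lt hx).trans (le_max_left _ _))
  have hle : ENNReal.ofReal (k ^ β) * μ {x | k < u x} ≤ ENNReal.ofReal (σ ^ β) :=
    (mul_le_mul_right (measure_mono hsub) _).trans h
  have hle' : μ {x | k < u x} ≤ ENNReal.ofReal ((σ / k) ^ β) := by
    rw [Real.div_rpow hσ0 hk.le, ENNReal.ofReal_div_of_pos (by positivity),
      ENNReal.le_div_iff_mul_le (Or.inl (ENNReal.ofReal_pos.2 (by positivity)).ne')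
        (Or.inl ENNReal.ofReal_ne_top), mul_comm]
    exact hle
  exact ⟨ne_top_of_le_ne_top ENNReal.ofReal_ne_top hle',
    ENNReal.toReal_le_of_le_ofReal (by positivity) hle'⟩

lemma ae_le_normOn_top {N : ℕ} {Ω : Set (EuclideanSpace ℝ (Fin N))}
    {f : EuclideanSpace ℝ (Fin N) → ℝ} (hf : MemLp f ∞ (volume.restrict Ω)) :
    ∀ᵐ x ∂(volume.restrict Ω), f x ≤ normOn Ω ∞ f := by
  have h := ae_le_eLpNormEssSup (f := f) (μ := volume.restrict Ω)
  filter_upwards [h] with x hx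
  rw [← eLpNorm_exponent_top] at hx
  refine (le_abs_self _).trans ?_
  have := ENNReal.toReal_mono hf.eLpNorm_ne_top hx
  rwa [toReal_enorm] at this

lemma lintegral_rpow_le_normOn_add {N : ℕ} {Ω : Set (EuclideanSpace ℝ (Fin N))} {r : ℝ}
    (hr : 1 ≤ r) {f g : EuclideanSpace ℝ (Fin N) → ℝ}
    (hf : MemLp f (ENNReal.ofReal r) (volume.restrict Ω))
    (hg : MemLp g (ENNReal.ofReal r) (volume.restrict Ω)) :
    (∫⁻ x in Ω, ENNReal.ofReal (f x + g x) ^ r) ^ (1 / r) ≤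
      ENNReal.ofReal ((normOn Ω (ENNReal.ofReal r) f : ℝ) + normOn Ω (ENNReal.ofReal r) g) := by
  have hr0 : 0 < r := by linarith
  have h := eLpNorm_add_le hf.1 hg.1 (show 1 ≤ ENNReal.ofReal r by
    simpa using ENNReal.ofReal_le_ofReal hr)
  rw [eLpNorm_eq_lintegral_rpow_enorm_toReal (by simpa using hr0) ENNReal.ofReal_ne_top,
    ENNReal.toReal_ofReal hr0.le] at h
  have e : ENNReal.ofReal ((normOn Ω (ENNReal.ofReal r) f : ℝ) + normOn Ω (ENNReal.ofReal r) g) =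
      eLpNorm f (ENNReal.ofReal r) (volume.restrict Ω) +
        eLpNorm g (ENNReal.ofReal r) (volume.restrict Ω) := by
    rw [ENNReal.ofReal_add (NNReal.coe_nonneg _) (NNReal.coe_nonneg _), ENNReal.ofReal_coe_nnreal,
      ENNReal.ofReal_coe_nnreal, normOn, normOn, ENNReal.coe_toNNReal hf.eLpNorm_ne_top,
      ENNReal.coe_toNNReal hg.eLpNorm_ne_top]
  rw [e]
  refine le_trans ?_ h
  gcongr with x
  rw [Pi.add_apply]
  exact Real.ofReal_le_enorm _

/-! ### Assembly of the global bound. -/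

theorem corollary2p2 (N : ℕ) (p β : ℝ) (hp : 1 < p) (hpN : p < N) (hβ : p < β) :
    ∃ θ₀ : ℝ, 0 < θ₀ ∧ θ₀ ≤ 1 ∧
      ∀ (q lam : ℝ), (N : ℝ) < q → 0 < lam →
      ∃ C : ℝ≥0 × ℝ≥0 × ℝ≥0 × ℝ≥0 × ℝ≥0 → ℝ≥0, Monotone C ∧
        ∀ (Ω : Set (EuclideanSpace ℝ (Fin N))), IsOpen Ω →
        ∀ (A : EuclideanSpace ℝ (Fin N) → ℝ → EuclideanSpace ℝ (Fin N) →
            EuclideanSpace ℝ (Fin N))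
          (B : EuclideanSpace ℝ (Fin N) → ℝ → EuclideanSpace ℝ (Fin N) → ℝ)
          (a₁ a₂ b₁ b₂ b₃ : EuclideanSpace ℝ (Fin N) → ℝ),
        IsCaratheodory Ω A → IsCaratheodory Ω B →
        (∀ᵐ x ∂(volume.restrict Ω),
          0 ≤ a₁ x ∧ 0 ≤ a₂ x ∧ 0 ≤ b₁ x ∧ 0 ≤ b₂ x ∧ 0 ≤ b₃ x) →
        StructureA Ω p lam a₁ a₂ A → StructureB Ω p b₁ b₂ b₃ B →
        MemLp b₁ ∞ (volume.restrict Ω) →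
        MemLp a₁ (ENNReal.ofReal (q / p)) (volume.restrict Ω) →
        MemLp b₂ (ENNReal.ofReal (q / p)) (volume.restrict Ω) →
        MemLp a₂ (ENNReal.ofReal (β / p)) (volume.restrict Ω) →
        MemLp a₂ ∞ (volume.restrict Ω) →
        MemLp b₃ (ENNReal.ofReal (β / (p - 1))) (volume.restrict Ω) →
        MemLp b₃ ∞ (volume.restrict Ω) →
        ∀ (u : EuclideanSpace ℝ (Fin N) → ℝ)
          (Du : EuclideanSpace ℝ (Fin N) → EuclideanSpace ℝ (Fin N)),
        IsWeakSubsolution Ω p A B u Du →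
        MemLp u (ENNReal.ofReal β) (volume.restrict Ω) →
        eLpNorm (fun x => max (u x) 0) ∞ (volume.restrict Ω) ≤
          (C (normOn Ω ∞ b₁,
              normOn Ω (ENNReal.ofReal (q / p)) a₁,
              normOn Ω (ENNReal.ofReal (q / p)) b₂,
              normOn Ω (ENNReal.ofReal (β / p)) a₂ + normOn Ω ∞ a₂,
              normOn Ω (ENNReal.ofReal (β / (p - 1))) b₃ + normOn Ω ∞ b₃) : ℝ≥0∞) *
            max (eLpNorm (fun x => max (u x) 0) (ENNReal.ofReal β) (volume.restrict Ω) ^ θ₀)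
              (eLpNorm (fun x => max (u x) 0) (ENNReal.ofReal β) (volume.restrict Ω)) := by
  have hp0 : 0 < p := by linarith
  have hN : (0 : ℝ) < N := by linarith
  have hβ0 : 0 < β := by linarith
  have hθ : 0 < β / (β + N) := by positivity
  refine ⟨β / (β + N), hθ, (div_le_one (by positivity)).2 (by linarith), ?_⟩
  intro q lam hq hlam
  have hq0 : 0 < q := by linarith
  obtain ⟨S, hS⟩ := exists_sobolev_const hp hpN
  have hs0 := sobolevExponent_pos hp hpN
  have hinv := inv_sobolevExponent hp hpN
  set s := sobolevExponent N p with hs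
  -- Hölder exponents: `a` for `a₁ + b₂` in `L^(q/p)`, `b` for the Sobolev term, and the surplus
  -- `δ₁`, positive because `q > N`.
  set a := p / q with ha
  set b := p / s with hb
  set δ₁ := p / N - p / q with hδ₁
  have ha0 : 0 < a := by positivity
  have hb0 : 0 < b := by positivity
  have hδ₁0 : 0 < δ₁ := sub_pos.2 (div_lt_div_of_pos_left hp0 hN hq)
  have hδ₁₂ : δ₁ ≤ p / N := by
    rw [hδ₁]
    exact sub_le_self _ ha0.le
  have hb1 : b + p / N = 1 := by
    rw [hb, div_eq_mul_inv, hinv]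
    field_simp
    ring
  have hab : a + b + δ₁ = 1 := by rw [ha, hδ₁]; linarith
  have hsb : s * b = p := by rw [hb]; field_simp
  set r : ℝ := 2 ^ (-p / δ₁) with hr
  have hr0 : 0 < r := by positivity
  have hr1 : r ≤ 1 :=
    Real.rpow_le_one_of_one_le_of_nonpos one_le_two
      (div_nonpos_of_nonpos_of_nonneg (by linarith) hδ₁0.le)
  set c := r ^ b / (4 * 4 ^ p) with hc
  have hc0 : 0 < c := by positivity
  have hc1 : c ≤ 1 := by
    rw [hc, div_le_one (by positivity)]
    have h1 : r ^ b ≤ 1 := Real.rpow_le_one hr0.le hr1 hb0.le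
    have h2 : (1 : ℝ) ≤ 4 ^ p := Real.one_le_rpow (by norm_num) hp0.le
    linarith
  set τ := 1 / (β * δ₁) + 1 / (p + β * p / N) with hτ
  have hτ0 : 0 < τ := by positivity
  refine ⟨fun n => supConst c τ (energyConst p lam S n), fun n n' hnn' =>
    supConst_mono hc0 hτ0.le (energyConst_nonneg hlam S.2 n)
      (energyConst_mono hp0 hlam S.2 hnn'), ?_⟩
  intro Ω _ A B a₁ a₂ b₁ b₂ b₃ _ hB hnn hSA hSB hb₁ ha₁ hb₂ _ ha₂ _ hb₃ u Du hu huβ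
  set n₁ := normOn Ω ∞ b₁ with hn₁
  set n₂ := normOn Ω (ENNReal.ofReal (q / p)) a₁ with hn₂
  set n₃ := normOn Ω (ENNReal.ofReal (q / p)) b₂ with hn₃
  set n₄ := normOn Ω (ENNReal.ofReal (β / p)) a₂ + normOn Ω ∞ a₂ with hn₄
  set n₅ := normOn Ω (ENNReal.ofReal (β / (p - 1))) b₃ + normOn Ω ∞ b₃ with hn₅
  set H := energyConst p lam S (n₁, n₂, n₃, n₄, n₅) with hH
  have hH0 : 0 ≤ H := energyConst_nonneg hlam S.2 _
  have hup : MemLp (fun x => max (u x) 0) (ENNReal.ofReal β) (volume.restrict Ω) := huβ.pos_part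
  set E := eLpNorm (fun x => max (u x) 0) (ENNReal.ofReal β) (volume.restrict Ω) with hE
  -- A vanishing norm is treated apart, since the starting level `K` would be zero.
  rcases eq_or_ne E 0 with hE0 | hE0
  · have hz := (eLpNorm_eq_zero_iff hup.1 (by simpa using hβ0)).1 hE0
    rw [eLpNorm_congr_ae hz]
    simp
  set σ := E.toReal with hσdef
  have hσ : 0 < σ := ENNReal.toReal_pos hE0 hup.eLpNorm_ne_top
  have hEσ : E = ENNReal.ofReal σ := (ENNReal.ofReal_toReal hup.eLpNorm_ne_top).symm
  set L := (1 / (c / (H + 1))) ^ τ with hL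
  set K := L * max (σ ^ (β / (β + N))) σ with hK
  -- Dividing by `H + 1` gives a threshold that stays at most `1` and still satisfies `H * (c / (H +
  -- 1)) ≤ c`, including when `H = 0`.
  have hcH : c / (H + 1) ≤ c := div_le_self hc0.le (by linarith)
  obtain ⟨hK0, hM1, hMδ₁, hMδ₂⟩ := exists_starting_level hp0 hN hβ0 hδ₁0
    (div_pos hc0 (by linarith)) (hcH.trans hc1) hσ hL hK
  have hHc : H * (c / (H + 1)) ≤ c := by
    rw [mul_div_assoc', div_le_iff₀ (by linarith)]
    nlinarith
  have hdist : ∀ k : ℝ, 0 < k → _ := fun k hk => measureReal_superlevel_le hβ0 hk hup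
  set P : ℝ := (2 / lam) ^ (p - 1) * (n₁ : ℝ) ^ p + (2 ^ p + 1) * n₅ + n₄ with hP
  have hP0 : 0 ≤ P := by positivity
  have hHeq : H = S ^ p * (2 / lam) * (2 ^ p * ((n₂ : ℝ) + n₃) + P) := rfl
  have hzero : (volume.restrict Ω).real {x | 2 * K < u x} = 0 := by
    refine deGiorgi_iteration (m := fun k => (volume.restrict Ω).real {x | k < u x})
      (fun k => measureReal_nonneg) (fun k l hk hkl => ?_) hp0 hb0 hδ₁0 hδ₁₂ hH0 hK0 hr ?_
      (hdist K hK0).2 hM1 ?_ ?_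
    · exact measureReal_mono (fun x hx => lt_of_le_of_lt hkl hx) (hdist k hk).1
    · intro k l hk hkl hm hsmall
      rw [hHeq] at hsmall ⊢
      refine level_decay hu.mem.1.1.aemeasurable (d := fun x => a₁ x + b₂ x) (a := a) (s := s)
        (ha₁.1.add hb₂.1).aemeasurable ?_ hp0 hP0 (by positivity) (by positivity) hk hkl ha0 hb0
        hδ₁0 hδ₁₂ hab hb1 hsb ?_ ?_ ?_ (hdist k hk).1 hm hsmall
      · filter_upwards [hnn] with x hx
        exact add_nonneg hx.1 hx.2.2.2.1
      · have := lintegral_rpow_le_normOn_add (by rw [one_le_div hp0]; linarith) ha₁ hb₂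
        rw [one_div_div] at this
        rwa [ha, one_div_div]
      · have h1 := lintegral_rpow_enorm_lt_top_of_eLpNorm_lt_top (by simpa using hs0)
          ENNReal.ofReal_ne_top hu.mem.1.2
        rw [ENNReal.toReal_ofReal hs0.le] at h1
        refine ne_top_of_le_ne_top h1.ne (lintegral_mono fun x => ?_)
        gcongr
        exact (ENNReal.ofReal_le_ofReal (by linarith)).trans (Real.ofReal_le_enorm _)
      · have h2 := level_sobolev_le hp hpN (hS Ω) hu.mem hk fun h hkh =>
          hu.lintegral_gradient_le hp hpN hlam hB hnn hSA hSB (n₁ := n₁) (n₄ := n₄) (n₅ := n₅)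
            (ae_le_normOn_top hb₁)
            ((ae_le_normOn_top ha₂).mono fun x hx => hx.trans (by simp [hn₄]))
            ((ae_le_normOn_top hb₃).mono fun x hx => hx.trans (by simp [hn₅]))
            n₁.2 n₄.2 n₅.2 ha₁.1 hb₂.1 hk hkh
        refine h2.trans_eq ?_
        rw [← mul_assoc, ENNReal.ofReal_mul (by positivity),
          ← ENNReal.ofReal_rpow_of_nonneg S.coe_nonneg hp0.le, ENNReal.ofReal_coe_nnreal]
    · exact (mul_le_mul_of_nonneg_left hMδ₁ hH0).trans hHc
    · refine (mul_le_mul_of_nonneg_left hMδ₂ hH0).trans ?_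
      rw [← mul_assoc]
      gcongr
  have hfin := (hdist (2 * K) (by linarith)).1
  rw [measureReal_eq_zero_iff hfin] at hzero
  have hae : ∀ᵐ x ∂(volume.restrict Ω), ‖max (u x) 0‖ ≤ 2 * K := by
    have : ∀ᵐ x ∂(volume.restrict Ω), ¬ 2 * K < u x := measure_eq_zero_iff_ae_notMem.1 hzero
    filter_upwards [this] with x hx
    rw [Real.norm_of_nonneg (le_max_right _ _)]
    exact max_le (not_lt.1 hx) (by linarith)
  rw [eLpNorm_exponent_top]
  refine (eLpNormEssSup_le_of_ae_bound hae).trans_eq ?_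
  have hL0 : 0 ≤ L := by positivity
  rw [hEσ, ENNReal.ofReal_rpow_of_pos hσ, ← ENNReal.ofReal_max]
  change _ = ENNReal.ofReal (2 * L) * _
  rw [← ENNReal.ofReal_mul (by positivity), hK, mul_assoc]
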